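/- Proposition (Explicit upper bound). Let $\Gamma=\{(s,t)\in\mathbb R^2: s>0,\ t>0\}$, and for $a\ge 1$ let $H_a=\overline{B_1((a,1))}$ be the closed unit disc centred at $(a,1)$ and $P_a=\Gamma\setminus H_a$. Let $W_a$ be the unique function that is continuous on $\overline{P_a}$, harmonic in $P_a$, and satisfies \[ W_a=0\ \text{ on }\partial\Gamma,\qquad W_a(s,t)=st\ \text{ on }\partial H_a,\qquad \int_{P_a}|\nabla W_a|^2\,ds\,dt<\infty , \] and let $\mathcal E(a)=\int_{P_a}|\nabla W_a|^2\,ds\,dt$. For $a=1$ (the disc tangent to both coordinate axes) the function $W_1$ exists and is unique, and \[ \mathcal E(1)\le \frac{55}{18}+\frac{275\pi}{64}<\pi(3+2\sqrt2). \] In particular, $\mathcal E(1)<\pi(3+2\sqrt2)$. -/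

import Mathlib

open InnerProductSpace

/-! The plane is `ℂ`, with coordinates `s = z.re` and `t = z.im`. -/

/-- The open quadrant `Γ = {s > 0, t > 0}`. -/
def quadrant : Set ℂ := {z | 0 < z.re ∧ 0 < z.im}

/-- The hole `H_a`: the closed unit disc centred at `(a, 1)`. -/
def hole (a : ℝ) : Set ℂ := Metric.closedBall (⟨a, 1⟩ : ℂ) 1

/-- The cell domain `P_a = Γ \ H_a`. -/
def cellDomain (a : ℝ) : Set ℂ := quadrant \ hole a

/-- `W` is a cell function for `a`: it is harmonic in `P_a`, it takes continuously the boundary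
values `0` on `∂Γ` and `s t` on `∂H_a`, and its Dirichlet energy on `P_a` is finite. -/
structure IsCellFunction (a : ℝ) (W : ℂ → ℝ) : Prop where
  harmonicContOnCl : HarmonicContOnCl W (cellDomain a)
  eq_zero : ∀ z ∈ frontier quadrant, W z = 0
  eq_mul : ∀ z ∈ frontier (hole a), W z = z.re * z.im
  finite_energy :
    MeasureTheory.IntegrableOn (fun z => ‖gradient W z‖ ^ 2) (cellDomain a) MeasureTheory.volume

/-- The Dirichlet energy `∫_Ω |∇W|² ds dt`. -/
noncomputable def dirichletEnergy (Ω : Set ℂ) (W : ℂ → ℝ) : ℝ :=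
  ∫ z in Ω, ‖gradient W z‖ ^ 2

/-- The cell function `W_a`. (Values off the closure of `P_a` are irrelevant; the existence of a
cell function and its uniqueness on that closure are not part of this definition.) -/
noncomputable def cellFunction (a : ℝ) : ℂ → ℝ := Classical.epsilon (IsCellFunction a)

/-- The cell energy `E(a) = ∫_{P_a} |∇W_a|² ds dt`. -/
noncomputable def cellEnergy (a : ℝ) : ℝ := dirichletEnergy (cellDomain a) (cellFunction a)

/-! The bound is Dirichlet's principle applied to one explicit competitor. Write `u = s t`, which is
harmonic, let `r` be the distance to `(1, 1)`, and take `V = u φ(r)` with `φ(r) = 16 / (1 + r)⁴`, so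
that `φ = 1` on the circle `r = 1`. Since `Δu = 0`, `|∇(uφ)|² = div(φ² u ∇u) + u² |∇φ|²`. Extend `φ`
by `1` to the hole. The divergence then integrates to zero over the whole quadrant, because `u`
vanishes on the axes and `φ` decays; inside the hole it equals `|∇u|² = |z|²`, of integral `5π/2`.
It therefore contributes `-5π/2` on `P_1`. The remaining term is estimated in polar coordinates by
`23.75`, and `23.75 - 5π/2` is below the stated bound (`integral_gradInner_trial_le`).

Existence comes from Perron's method (`exists_harmonicOnNhd_between`) between `max 0 holeBarrier`
and `min (s t) (256 s t / |z|⁴)`. These barriers force continuity at every boundary point, including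
the corner and the two points of tangency, and decay at infinity. `dirichlet_principle` then
compares `W` with `V` using test functions that are truncations of `W - V`: they have compact
support in the domain, so neither boundary regularity nor prior finiteness of the energy of `W` is
needed.

Uniqueness must hold without any decay hypothesis. It rests on the parabolicity of the plane:
rescaled cutoffs have a Dirichlet energy independent of the scale, so a finite-energy harmonic
function with zero boundary values vanishes (`eq_zero_of_integrableOn_gradInner`). -/

open Real Metric Filter Topology Set

/-! ### Sub-mean-value functions and the maximum principle on a disc -/

/-- Continuous functions satisfying the sub-mean value inequality on all small circles. -/
structure IsSubmean (u : ℂ → ℝ) (Ω : Set ℂ) : Prop where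
  continuousOn : ContinuousOn u Ω
  le_circleAverage : ∀ z ∈ Ω, ∀ᶠ r in 𝓝[>] (0 : ℝ), u z ≤ circleAverage u z r

lemma IsOpen.eventually_closedBall_subset {Ω : Set ℂ} (hΩ : IsOpen Ω) {z : ℂ} (hz : z ∈ Ω) :
    ∀ᶠ r in 𝓝[>] (0 : ℝ), 0 < r ∧ closedBall z r ⊆ Ω := by
  obtain ⟨ε, hε, h⟩ := nhds_basis_closedBall.mem_iff.1 (hΩ.mem_nhds hz)
  filter_upwards [Ioc_mem_nhdsGT hε] with r hr
  exact ⟨hr.1, (closedBall_subset_closedBall hr.2).trans h⟩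

lemma ContinuousOn.circleIntegrable_of_closedBall_subset {u : ℂ → ℝ} {Ω : Set ℂ}
    (hu : ContinuousOn u Ω) {z : ℂ} {r : ℝ} (hr : 0 < r) (h : closedBall z r ⊆ Ω) :
    CircleIntegrable u z r :=
  (hu.mono (sphere_subset_closedBall.trans h)).circleIntegrable hr.le

lemma IsSubmean.mono {u : ℂ → ℝ} {Ω Ω' : Set ℂ} (hu : IsSubmean u Ω) (h : Ω' ⊆ Ω) :
    IsSubmean u Ω' :=
  ⟨hu.1.mono h, fun z hz ↦ hu.2 z (h hz)⟩

lemma IsSubmean.add {u v : ℂ → ℝ} {Ω : Set ℂ} (hΩ : IsOpen Ω) (hu : IsSubmean u Ω)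
    (hv : IsSubmean v Ω) : IsSubmean (fun z ↦ u z + v z) Ω := by
  refine ⟨hu.1.add hv.1, fun z hz ↦ ?_⟩
  filter_upwards [hu.2 z hz, hv.2 z hz, hΩ.eventually_closedBall_subset hz] with r h1 h2 h3
  rw [circleAverage_fun_add (hu.1.circleIntegrable_of_closedBall_subset h3.1 h3.2)
    (hv.1.circleIntegrable_of_closedBall_subset h3.1 h3.2)]
  exact add_le_add h1 h2

lemma IsSubmean.sup {u v : ℂ → ℝ} {Ω : Set ℂ} (hΩ : IsOpen Ω) (hu : IsSubmean u Ω)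
    (hv : IsSubmean v Ω) : IsSubmean (fun z ↦ max (u z) (v z)) Ω := by
  have hc : ContinuousOn (fun z ↦ max (u z) (v z)) Ω := hu.1.sup hv.1
  refine ⟨hc, fun z hz ↦ ?_⟩
  filter_upwards [hu.2 z hz, hv.2 z hz, hΩ.eventually_closedBall_subset hz] with r h1 h2 h3
  have hi := hc.circleIntegrable_of_closedBall_subset h3.1 h3.2
  refine max_le (h1.trans ?_) (h2.trans ?_)
  · exact circleAverage_mono (hu.1.circleIntegrable_of_closedBall_subset h3.1 h3.2) hi
      fun _ _ ↦ le_max_left _ _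
  · exact circleAverage_mono (hv.1.circleIntegrable_of_closedBall_subset h3.1 h3.2) hi
      fun _ _ ↦ le_max_right _ _

lemma InnerProductSpace.HarmonicOnNhd.isSubmean {u : ℂ → ℝ} {Ω : Set ℂ} (hΩ : IsOpen Ω)
    (hu : HarmonicOnNhd u Ω) : IsSubmean u Ω := by
  refine ⟨fun z hz ↦ (hu z hz).1.continuousAt.continuousWithinAt, fun z hz ↦ ?_⟩
  filter_upwards [hΩ.eventually_closedBall_subset hz] with r hr
  have : HarmonicOnNhd u (closedBall z |r|) := by
    rw [abs_of_pos hr.1]; exact hu.mono hr.2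
  exact this.circleAverage_eq.ge

lemma circleAverage_lt_of_le_of_exists_lt {u : ℂ → ℝ} {z : ℂ} {r m : ℝ} (hr : 0 < r)
    (hu : ContinuousOn u (sphere z r)) (hle : ∀ w ∈ sphere z r, u w ≤ m)
    (hlt : u (z + r) < m) : circleAverage u z r < m := by
  have hmem : ∀ θ, circleMap z r θ ∈ sphere z r := fun θ ↦ circleMap_mem_sphere z hr.le θ
  have h1 : ∫ θ in (0 : ℝ)..2 * π, u (circleMap z r θ) < ∫ _θ in (0 : ℝ)..2 * π, m := by
    refine intervalIntegral.integral_lt_integral_of_continuousOn_of_le_of_exists_lt (by positivity)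
      ?_ continuousOn_const (fun θ _ ↦ hle _ (hmem θ)) ⟨0, by simp [Real.pi_pos.le], ?_⟩
    · exact hu.comp (continuous_circleMap z r).continuousOn fun θ _ ↦ hmem θ
    · simpa [circleMap] using hlt
  rw [circleAverage_def, smul_eq_mul]
  rw [intervalIntegral.integral_const, smul_eq_mul, sub_zero] at h1
  calc _ < (2 * π)⁻¹ * (2 * π * m) := by gcongr
    _ = m := by field_simp

/-- Maximum principle on a disc. -/
lemma IsSubmean.le_zero_of_sphere {v : ℂ → ℝ} {c : ℂ} {R : ℝ} (hv : IsSubmean v (ball c R))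
    (hc : ContinuousOn v (closedBall c R)) (hs : ∀ z ∈ sphere c R, v z ≤ 0) :
    ∀ z ∈ closedBall c R, v z ≤ 0 := by
  intro z₀ hz₀
  obtain ⟨z₁, hz₁, hmax⟩ := (isCompact_closedBall c R).exists_isMaxOn ⟨z₀, hz₀⟩ hc
  by_contra! hpos
  have hm : 0 < v z₁ := hpos.trans_le (hmax hz₀)
  set K := closedBall c R ∩ v ⁻¹' {v z₁} with hK
  have hKc : IsCompact K := (isCompact_closedBall c R).of_isClosed_subset
    (hc.preimage_isClosed_of_isClosed isClosed_closedBall isClosed_singleton) inter_subset_left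
  -- Among the maximum points, take one with the largest real part. The point `z + r` of a small
  -- circle then has a strictly smaller value, so the average over that circle is strictly below the
  -- maximum.
  obtain ⟨z, hz, hre⟩ := hKc.exists_isMaxOn ⟨z₁, hz₁, rfl⟩ Complex.continuous_re.continuousOn
  have hzv : v z = v z₁ := hz.2
  have hzb : z ∈ ball c R := by
    rcases (mem_closedBall.1 hz.1).lt_or_eq with h | h
    · exact h
    · exact absurd (hs z h) (by rw [hzv]; exact hm.not_ge)
  obtain ⟨r, hr, hr0, hsub⟩ := ((hv.2 z hzb).and (isOpen_ball.eventually_closedBall_subset hzb)).exists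
  have hzr : z + r ∈ sphere z r := by simp [abs_of_pos hr0]
  refine hr.not_gt ?_
  have hsub' := hsub.trans ball_subset_closedBall
  refine circleAverage_lt_of_le_of_exists_lt hr0
    (hc.mono (sphere_subset_closedBall.trans hsub'))
    (fun w hw ↦ hzv ▸ hmax (hsub' (sphere_subset_closedBall hw))) ?_
  have hin := hsub' (sphere_subset_closedBall hzr)
  refine lt_of_le_of_ne (hzv ▸ hmax hin) fun heq ↦ ?_
  have := hre (show z + r ∈ K from ⟨hin, by simp [heq, hzv]⟩)
  simp at this
  linarith

/-! ### The Poisson integral and its boundary values -/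

/-- The Poisson integral over the circle of centre `c` and radius `R`. -/
noncomputable def poissonIntegral (f : ℂ → ℝ) (c : ℂ) (R : ℝ) (w : ℂ) : ℝ :=
  circleAverage (poissonKernel c w • f) c R

/-- It is the real part of the Herglotz integral, which is analytic; the substitution `z ↦ z + c`
reduces to discs centred at `0`. Only integrability of the data is assumed, since Perron's limit is
applied here before its continuity is known. -/
lemma poissonIntegral_harmonicOnNhd {f : ℂ → ℝ} {c : ℂ} {R : ℝ} (hf : CircleIntegrable f c R) :
    HarmonicOnNhd (poissonIntegral f c R) (ball c R) := by
  set g : ℂ → ℝ := fun z ↦ f (z + c) with hg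
  have hgi : CircleIntegrable g 0 R := by
    have : (fun θ ↦ g (circleMap 0 R θ)) = fun θ ↦ f (circleMap c R θ) := by
      funext θ; simp [hg, circleMap, add_comm]
    rw [CircleIntegrable, this]; exact hf
  have hgi' : CircleIntegrable (fun z ↦ (g z : ℂ)) 0 R := by
    simp only [CircleIntegrable, intervalIntegrable_iff] at hgi ⊢
    exact Complex.ofRealCLM.integrable_comp hgi
  set F : ℂ → ℂ := fun w ↦ circleAverage (fun ζ ↦ herglotzRieszKernel 0 w ζ • (g ζ : ℂ)) 0 R
  have hF := analyticOnNhd_circleAverage_herglotzRieszKernel_smul hgi'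
  have hkey : ∀ w ∈ ball c R, poissonIntegral f c R w = (F (w - c)).re := by
    intro w hw
    have hw' : w - c ∈ ball 0 R := by simpa [dist_eq_norm] using hw
    rw [re_circleAverage_herglotzRieszKernel_smul hgi hw', poissonIntegral,
      ← circleAverage_map_add_const]
    congr 1
    funext z
    simp [poissonKernel_eq_re_herglotzRieszKernel, herglotzRieszKernel_add_const, hg]
  intro w hw
  have hw' : w - c ∈ ball 0 R := by simpa [dist_eq_norm] using hw
  have h1 : AnalyticAt ℂ (fun w ↦ F (w - c)) w :=
    AnalyticAt.fun_comp (hF (w - c) hw') (by fun_prop)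
  refine (harmonicAt_congr_nhds ?_).2 h1.harmonicAt_re
  filter_upwards [isOpen_ball.mem_nhds hw] with z hz using hkey z hz

lemma poissonIntegral_eq {f : ℂ → ℝ} {c : ℂ} {R : ℝ} (hf : HarmonicOnNhd f (closedBall c R))
    {w : ℂ} (hw : w ∈ ball c R) : poissonIntegral f c R w = f w :=
  hf.circleAverage_poissonKernel_smul hw

lemma poissonKernel_nonneg_of_mem {c w z : ℂ} {R : ℝ} (hw : w ∈ ball c R) (hz : z ∈ sphere c R) :
    0 ≤ poissonKernel c w z := by
  rw [poissonKernel_def]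
  rw [mem_sphere, dist_eq_norm] at hz
  rw [mem_ball, dist_eq_norm] at hw
  have := norm_nonneg (w - c)
  have : ‖w - c‖ ^ 2 ≤ ‖z - c‖ ^ 2 := by rw [hz]; gcongr
  exact div_nonneg (by linarith) (by positivity)

lemma continuousOn_poissonKernel {c w : ℂ} {R : ℝ} (hw : w ∈ ball c R) :
    ContinuousOn (poissonKernel c w) (sphere c R) := by
  have hR : 0 < R := pos_of_mem_ball hw
  have := continuousOn_herglotzRieszKernel_sphere hw
  rw [abs_of_pos hR] at this
  rw [poissonKernel_eq_re_herglotzRieszKernel]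
  exact Complex.continuous_re.comp_continuousOn this

lemma ContinuousOn.circleIntegrable_poissonKernel_smul {f : ℂ → ℝ} {c w : ℂ} {R : ℝ}
    (hf : ContinuousOn f (sphere c R)) (hw : w ∈ ball c R) :
    CircleIntegrable (poissonKernel c w • f) c R :=
  ((continuousOn_poissonKernel hw).smul hf).circleIntegrable (pos_of_mem_ball hw).le

lemma poissonIntegral_mono {f g : ℂ → ℝ} {c w : ℂ} {R : ℝ} (hf : ContinuousOn f (sphere c R))
    (hg : ContinuousOn g (sphere c R)) (hw : w ∈ ball c R) (h : ∀ z ∈ sphere c R, f z ≤ g z) :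
    poissonIntegral f c R w ≤ poissonIntegral g c R w := by
  refine circleAverage_mono (hf.circleIntegrable_poissonKernel_smul hw)
    (hg.circleIntegrable_poissonKernel_smul hw) fun z hz ↦ ?_
  rw [abs_of_pos (pos_of_mem_ball hw)] at hz
  simpa using mul_le_mul_of_nonneg_left (h z hz) (poissonKernel_nonneg_of_mem hw hz)

lemma harmonicOnNhd_affine (a C : ℝ) (p q : ℂ) (s : Set ℂ) :
    HarmonicOnNhd (fun w : ℂ ↦ a + C * ((w - q) * p).re) s := by
  intro w _
  have : AnalyticAt ℂ (fun w : ℂ ↦ (a : ℂ) + C * ((w - q) * p)) w := by fun_prop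
  have h := this.harmonicAt_re
  have e : (fun w : ℂ ↦ ((a : ℂ) + C * ((w - q) * p)).re) =
      fun w : ℂ ↦ a + C * ((w - q) * p).re := by
    funext w
    rw [Complex.add_re, Complex.re_ofReal_mul, Complex.ofReal_re]
  rwa [e] at h

lemma norm_sub_sq_of_mem_sphere {c z z₀ : ℂ} {R : ℝ} (hz : z ∈ sphere c R)
    (hz₀ : z₀ ∈ sphere c R) :
    ‖z - z₀‖ ^ 2 = 2 * R ^ 2 - 2 * ((z - c) * (starRingEnd ℂ) (z₀ - c)).re := by
  rw [mem_sphere, dist_eq_norm] at hz hz₀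
  have h : ‖z - z₀‖ ^ 2 = ‖(z - c) - (z₀ - c)‖ ^ 2 := by congr 2; ring
  rw [h, ← Complex.normSq_eq_norm_sq, Complex.normSq_sub, Complex.normSq_eq_norm_sq,
    Complex.normSq_eq_norm_sq, hz, hz₀]
  ring

/-- **Schwarz**: the Poisson integral attains continuous boundary values. -/
lemma tendsto_poissonIntegral {f : ℂ → ℝ} {c z₀ : ℂ} {R : ℝ} (hf : ContinuousOn f (sphere c R))
    (hz₀ : z₀ ∈ sphere c R) :
    Tendsto (poissonIntegral f c R) (𝓝[ball c R] z₀) (𝓝 (f z₀)) := by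
  have hbd : ∃ M, ∀ z ∈ sphere c R, |f z| ≤ M := by
    obtain ⟨M, hM⟩ := (isCompact_sphere c R).exists_bound_of_continuousOn hf
    exact ⟨M, hM⟩
  obtain ⟨M, hM⟩ := hbd
  rw [tendsto_order]
  -- Near `z₀` the `ε` suffices by continuity; away from it the quadratic term exceeds the
  -- oscillation `2 M`.
  have key : ∀ ε > 0, ∃ C, ∀ z ∈ sphere c R, |f z - f z₀| ≤ ε + C * ‖z - z₀‖ ^ 2 := by
    intro ε hε
    obtain ⟨δ, hδ, h⟩ := Metric.continuousOn_iff.1 hf z₀ hz₀ ε hε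
    have hM0 : 0 ≤ M := (abs_nonneg _).trans (hM z₀ hz₀)
    refine ⟨2 * M / δ ^ 2, fun z hz ↦ ?_⟩
    by_cases hd : dist z z₀ < δ
    · have := (h z hz hd).le
      rw [Real.dist_eq] at this
      have : 0 ≤ 2 * M / δ ^ 2 * ‖z - z₀‖ ^ 2 := by positivity
      linarith
    · push Not at hd
      rw [dist_eq_norm] at hd
      have h1 : |f z - f z₀| ≤ 2 * M := by
        have := abs_sub (f z) (f z₀)
        linarith [hM z hz, hM z₀ hz₀]
      have h2 : 2 * M ≤ 2 * M / δ ^ 2 * ‖z - z₀‖ ^ 2 := by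
        rw [div_mul_eq_mul_div, le_div_iff₀ (by positivity)]
        gcongr
      linarith
  -- On the circle `‖z - z₀‖²` coincides with a real affine function. Affine functions are harmonic,
  -- so the Poisson integral reproduces them and no kernel estimate is needed.
  have key2 : ∀ ε > 0, ∃ q : ℂ → ℝ, Continuous q ∧ q z₀ = ε ∧
      ∀ w ∈ ball c R, |poissonIntegral f c R w - f z₀| ≤ q w := by
    intro ε hε
    obtain ⟨C, hC⟩ := key ε hε
    set p := (starRingEnd ℂ) (z₀ - c)
    refine ⟨fun w ↦ (ε + 2 * C * R ^ 2) + (-2 * C) * ((w - c) * p).re, by fun_prop, ?_, ?_⟩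
    · have := norm_sub_sq_of_mem_sphere hz₀ hz₀
      simp only [sub_self, norm_zero] at this
      linear_combination (-C) * this
    intro w hw
    have hb : ∀ z ∈ sphere c R, ε + C * ‖z - z₀‖ ^ 2 =
        (ε + 2 * C * R ^ 2) + (-2 * C) * ((z - c) * p).re := fun z hz ↦ by
      rw [norm_sub_sq_of_mem_sphere hz hz₀]; ring
    rw [abs_le]
    have c1 : ∀ a D : ℝ, ContinuousOn (fun w : ℂ ↦ a + D * ((w - c) * p).re) (sphere c R) :=
      fun a D ↦ by fun_prop
    constructor
    · have h1 := poissonIntegral_mono (c1 (f z₀ - (ε + 2 * C * R ^ 2)) (2 * C)) hf hw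
        (fun z hz ↦ by
          have := (abs_le.1 (hC z hz)).1
          rw [hb z hz] at this; linarith)
      rw [poissonIntegral_eq (harmonicOnNhd_affine _ _ _ _ _) hw] at h1
      linarith
    · have h1 := poissonIntegral_mono hf (c1 (f z₀ + (ε + 2 * C * R ^ 2)) (-2 * C)) hw
        (fun z hz ↦ by
          have := (abs_le.1 (hC z hz)).2
          rw [hb z hz] at this; linarith)
      rw [poissonIntegral_eq (harmonicOnNhd_affine _ _ _ _ _) hw] at h1
      linarith
  have key3 : ∀ ε > 0, ∀ᶠ w in 𝓝[ball c R] z₀, |poissonIntegral f c R w - f z₀| < ε := by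
    intro ε hε
    obtain ⟨q, hq, hq0, h⟩ := key2 (ε / 2) (by positivity)
    have : ∀ᶠ w in 𝓝[ball c R] z₀, q w < ε :=
      (hq.continuousAt.eventually_lt continuousAt_const (by rw [hq0]; linarith)).filter_mono
        nhdsWithin_le_nhds
    filter_upwards [this, self_mem_nhdsWithin] with w h1 h2
    exact (h w h2).trans_lt h1
  constructor
  · intro a ha
    filter_upwards [key3 (f z₀ - a) (by linarith)] with w hw
    linarith [(abs_lt.1 hw).1]
  · intro a ha
    filter_upwards [key3 (a - f z₀) (by linarith)] with w hw
    linarith [(abs_lt.1 hw).2]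

/-! ### Poisson lifts -/

open Classical in
/-- Replace `f` on a disc by the Poisson integral of its boundary values. -/
noncomputable def poissonLift (f : ℂ → ℝ) (c : ℂ) (R : ℝ) (z : ℂ) : ℝ :=
  if z ∈ ball c R then poissonIntegral f c R z else f z

lemma poissonLift_of_mem {f : ℂ → ℝ} {c z : ℂ} {R : ℝ} (hz : z ∈ ball c R) :
    poissonLift f c R z = poissonIntegral f c R z := if_pos hz

lemma poissonLift_of_notMem {f : ℂ → ℝ} {c z : ℂ} {R : ℝ} (hz : z ∉ ball c R) :
    poissonLift f c R z = f z := if_neg hz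

lemma poissonLift_harmonicOnNhd {f : ℂ → ℝ} {c : ℂ} {R : ℝ} (hf : CircleIntegrable f c R) :
    HarmonicOnNhd (poissonLift f c R) (ball c R) := fun z hz ↦ by
  refine (harmonicAt_congr_nhds ?_).2 (poissonIntegral_harmonicOnNhd hf z hz)
  filter_upwards [isOpen_ball.mem_nhds hz] with w hw using poissonLift_of_mem hw

lemma continuousOn_poissonLift {f : ℂ → ℝ} {c : ℂ} {R : ℝ} {Ω : Set ℂ} (hR : 0 < R)
    (hf : ContinuousOn f Ω) (hB : closedBall c R ⊆ Ω) :
    ContinuousOn (poissonLift f c R) Ω := by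
  have hfs := hf.mono (sphere_subset_closedBall.trans hB)
  intro z hz
  by_cases hzb : z ∈ ball c R
  · exact (poissonLift_harmonicOnNhd (hfs.circleIntegrable hR.le) z
      hzb).1.continuousAt.continuousWithinAt
  have hval : poissonLift f c R z = f z := poissonLift_of_notMem hzb
  have hout : Tendsto (poissonLift f c R) (𝓝[Ω ∩ (ball c R)ᶜ] z) (𝓝 (f z)) := by
    refine ((hf z hz).mono_left (nhdsWithin_mono _ inter_subset_left)).congr' ?_
    filter_upwards [self_mem_nhdsWithin] with w hw using (poissonLift_of_notMem hw.2).symm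
  have hin : Tendsto (poissonLift f c R) (𝓝[Ω ∩ ball c R] z) (𝓝 (f z)) := by
    by_cases hzs : z ∈ sphere c R
    · refine ((tendsto_poissonIntegral hfs hzs).mono_left
        (nhdsWithin_mono _ inter_subset_right)).congr' ?_
      filter_upwards [self_mem_nhdsWithin] with w hw using (poissonLift_of_mem hw.2).symm
    · have : z ∈ (closedBall c R)ᶜ := fun h ↦ by
        rw [← ball_union_sphere] at h
        exact h.elim hzb hzs
      have h0 : 𝓝[Ω ∩ ball c R] z = ⊥ := by
        rw [← empty_mem_iff_bot]
        filter_upwards [self_mem_nhdsWithin, nhdsWithin_le_nhds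
          (isClosed_closedBall.isOpen_compl.mem_nhds this)] with w h1 h2
        exact h2 (ball_subset_closedBall h1.2)
      rw [h0]; exact tendsto_bot
  have := hin.sup hout
  rw [← nhdsWithin_union, inter_union_compl] at this
  rw [ContinuousWithinAt, hval]
  exact this

lemma IsSubmean.le_poissonLift {f : ℂ → ℝ} {c : ℂ} {R : ℝ} {Ω : Set ℂ}
    (hR : 0 < R) (hf : IsSubmean f Ω) (hB : closedBall c R ⊆ Ω) (z : ℂ) :
    f z ≤ poissonLift f c R z := by
  by_cases hz : z ∈ ball c R
  swap
  · rw [poissonLift_of_notMem hz]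
  have hc := continuousOn_poissonLift hR hf.1 hB
  have hball : ball c R ⊆ Ω := ball_subset_closedBall.trans hB
  have hs : IsSubmean (fun z ↦ f z + -poissonLift f c R z) (ball c R) :=
    (hf.mono hball).add isOpen_ball
      (HarmonicOnNhd.isSubmean isOpen_ball (poissonLift_harmonicOnNhd
        ((hf.1.mono (sphere_subset_closedBall.trans hB)).circleIntegrable hR.le)).neg)
  have := hs.le_zero_of_sphere ((hf.1.mono hB).add (hc.mono hB).neg) (fun z hz ↦ by
    rw [poissonLift_of_notMem]
    · simp
    · exact fun h ↦ (mem_ball.1 h).ne hz) z (ball_subset_closedBall hz)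
  linarith

lemma poissonLift_le {f U : ℂ → ℝ} {c : ℂ} {R : ℝ} {Ω : Set ℂ}
    (hR : 0 < R) (hf : ContinuousOn f Ω) (hB : closedBall c R ⊆ Ω)
    (hU : IsSubmean (fun z ↦ -U z) Ω) (hle : ∀ z ∈ Ω, f z ≤ U z) :
    ∀ z ∈ Ω, poissonLift f c R z ≤ U z := by
  intro z hzΩ
  by_cases hz : z ∈ ball c R
  swap
  · rw [poissonLift_of_notMem hz]; exact hle z hzΩ
  have hc := continuousOn_poissonLift hR hf hB
  have hball : ball c R ⊆ Ω := ball_subset_closedBall.trans hB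
  have hs : IsSubmean (fun z ↦ poissonLift f c R z + -U z) (ball c R) :=
    (HarmonicOnNhd.isSubmean isOpen_ball (poissonLift_harmonicOnNhd
        ((hf.mono (sphere_subset_closedBall.trans hB)).circleIntegrable hR.le))).add isOpen_ball
      (hU.mono hball)
  have := hs.le_zero_of_sphere ((hc.mono hB).add (hU.1.mono hB)) (fun z hz ↦ by
    rw [poissonLift_of_notMem]
    · linarith [hle z (hB (sphere_subset_closedBall hz))]
    · exact fun h ↦ (mem_ball.1 h).ne hz) z (ball_subset_closedBall hz)
  linarith

/-- Inside the disc the lift is harmonic. Elsewhere, the bounding circle included, its value is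
still that of `f`, while its circle averages can only have grown. -/
lemma IsSubmean.isSubmean_poissonLift {f : ℂ → ℝ} {c : ℂ} {R : ℝ} {Ω : Set ℂ} (hΩ : IsOpen Ω)
    (hR : 0 < R) (hf : IsSubmean f Ω) (hB : closedBall c R ⊆ Ω) :
    IsSubmean (poissonLift f c R) Ω := by
  have hc := continuousOn_poissonLift hR hf.1 hB
  refine ⟨hc, fun z hz ↦ ?_⟩
  by_cases hzb : z ∈ ball c R
  · exact (HarmonicOnNhd.isSubmean isOpen_ball (poissonLift_harmonicOnNhd
        ((hf.1.mono (sphere_subset_closedBall.trans hB)).circleIntegrable hR.le))).2 z hzb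
  filter_upwards [hf.2 z hz, hΩ.eventually_closedBall_subset hz] with r h1 h3
  rw [poissonLift_of_notMem hzb]
  exact h1.trans (circleAverage_mono (hf.1.circleIntegrable_of_closedBall_subset h3.1 h3.2)
    (hc.circleIntegrable_of_closedBall_subset h3.1 h3.2)
    fun w _ ↦ hf.le_poissonLift hR hB w)

/-! ### Perron's method with a countable family of discs -/

lemma exists_closedBall_sequence {Ω : Set ℂ} (hΩ : IsOpen Ω) (hne : Ω.Nonempty) :
    ∃ (c : ℕ → ℂ) (R : ℕ → ℝ), (∀ n, 0 < R n ∧ closedBall (c n) (R n) ⊆ Ω) ∧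
      ∀ z ∈ Ω, ∃ n, z ∈ ball (c n) (R n) := by
  have h : ∀ z : Ω, ∃ r, 0 < r ∧ closedBall (z : ℂ) r ⊆ Ω := fun z ↦
    (hΩ.eventually_closedBall_subset z.2).exists
  choose r hr hsub using h
  obtain ⟨T, hT, hTU⟩ := TopologicalSpace.isOpen_iUnion_countable
    (fun z : Ω ↦ ball (z : ℂ) (r z)) fun _ ↦ isOpen_ball
  have hcov : ∀ z ∈ Ω, ∃ i ∈ T, z ∈ ball (i : ℂ) (r i) := fun z hz ↦ by
    have : z ∈ ⋃ i ∈ T, ball (i : ℂ) (r i) := by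
      rw [hTU]; exact mem_iUnion.2 ⟨⟨z, hz⟩, mem_ball_self (hr _)⟩
    simpa using this
  have hTne : T.Nonempty := by
    obtain ⟨z, hz⟩ := hne
    obtain ⟨i, hi, -⟩ := hcov z hz
    exact ⟨i, hi⟩
  obtain ⟨e, he⟩ := hT.exists_eq_range hTne
  refine ⟨fun n ↦ e n, fun n ↦ r (e n), fun n ↦ ⟨hr _, hsub _⟩, fun z hz ↦ ?_⟩
  obtain ⟨i, hi, hz⟩ := hcov z hz
  rw [he] at hi
  obtain ⟨n, rfl⟩ := hi
  exact ⟨n, hz⟩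

/-- Successive Poisson lifts over the discs of a sequence. -/
noncomputable def perronSeq (L : ℂ → ℝ) (c : ℕ → ℂ) (R : ℕ → ℝ) : ℕ → ℂ → ℝ
  | 0 => L
  | n + 1 => poissonLift (perronSeq L c R n) (c n) (R n)

/-- **Perron's method**: between a continuous subharmonic function and a continuous superharmonic
function lies a harmonic function. -/
theorem exists_harmonicOnNhd_between {L U : ℂ → ℝ} {Ω : Set ℂ} (hΩ : IsOpen Ω)
    (hL : IsSubmean L Ω) (hU : IsSubmean (fun z ↦ -U z) Ω) (hLU : ∀ z ∈ Ω, L z ≤ U z) :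
    ∃ W : ℂ → ℝ, HarmonicOnNhd W Ω ∧ ∀ z ∈ Ω, L z ≤ W z ∧ W z ≤ U z := by
  rcases Ω.eq_empty_or_nonempty with rfl | hne
  · exact ⟨L, fun z hz ↦ hz.elim, fun z hz ↦ hz.elim⟩
  obtain ⟨c₀, R₀, hB₀, hcov⟩ := exists_closedBall_sequence hΩ hne
  -- Unpairing the index makes every disc of the cover recur infinitely often.
  set c : ℕ → ℂ := fun n ↦ c₀ n.unpair.1
  set R : ℕ → ℝ := fun n ↦ R₀ n.unpair.1
  have hB : ∀ n, 0 < R n ∧ closedBall (c n) (R n) ⊆ Ω := fun n ↦ hB₀ _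
  set u := perronSeq L c R
  have hu0 : u 0 = L := rfl
  have hus : ∀ n, u (n + 1) = poissonLift (u n) (c n) (R n) := fun n ↦ rfl
  have hsub : ∀ n, IsSubmean (u n) Ω := fun n ↦ by
    induction n with
    | zero => exact hL
    | succ n ih => rw [hus]; exact ih.isSubmean_poissonLift hΩ (hB n).1 (hB n).2
  have hle : ∀ n, ∀ z ∈ Ω, u n z ≤ U z := fun n ↦ by
    induction n with
    | zero => exact hLU
    | succ n ih =>
      rw [hus]; exact poissonLift_le (hB n).1 (hsub n).1 (hB n).2 hU ih
  have hmono : ∀ z, Monotone fun n ↦ u n z := fun z ↦ monotone_nat_of_le_succ fun n ↦ by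
    rw [hus]; exact (hsub n).le_poissonLift (hB n).1 (hB n).2 z
  set W : ℂ → ℝ := fun z ↦ ⨆ n, u n z
  have hbdd : ∀ z ∈ Ω, BddAbove (range fun n ↦ u n z) := fun z hz ↦
    ⟨U z, by rintro _ ⟨n, rfl⟩; exact hle n z hz⟩
  have hlim : ∀ z ∈ Ω, Tendsto (fun n ↦ u n z) atTop (𝓝 (W z)) := fun z hz ↦
    tendsto_atTop_ciSup (hmono z) (hbdd z hz)
  refine ⟨W, ?_, fun z hz ↦ ⟨?_, ?_⟩⟩
  rotate_left
  · exact le_ciSup (hbdd z hz) 0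
  · exact ciSup_le fun n ↦ hle n z hz
  intro z hz
  obtain ⟨k, hk⟩ := hcov z hz
  set p := c₀ k
  set ρ := R₀ k
  have hρ : 0 < ρ := (hB₀ k).1
  have hsph : sphere p ρ ⊆ Ω := sphere_subset_closedBall.trans (hB₀ k).2
  have hmem : ∀ θ, circleMap p ρ θ ∈ sphere p ρ := fun θ ↦ circleMap_mem_sphere p hρ.le θ
  have hcirc : ∀ n, Continuous fun θ ↦ u n (circleMap p ρ θ) := fun n ↦
    continuousOn_univ.1 (((hsub n).1.mono hsph).comp (continuous_circleMap p ρ).continuousOn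
      fun θ _ ↦ hmem θ)
  have hlimθ : ∀ θ, Tendsto (fun n ↦ u n (circleMap p ρ θ)) atTop (𝓝 (W (circleMap p ρ θ))) :=
    fun θ ↦ hlim _ (hsph (hmem θ))
  have hUc : ContinuousOn U Ω := hU.1.neg.congr fun z _ ↦ (neg_neg _).symm
  obtain ⟨M₁, hM₁⟩ := (isCompact_sphere p ρ).exists_bound_of_continuousOn (hL.1.mono hsph)
  obtain ⟨M₂, hM₂⟩ := (isCompact_sphere p ρ).exists_bound_of_continuousOn (hUc.mono hsph)
  have hbound : ∀ n, ∀ w ∈ sphere p ρ, |u n w| ≤ max M₁ M₂ := fun n w hw ↦ by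
    refine abs_le.2 ⟨?_, ?_⟩
    · have h1 := hmono w n.zero_le
      have h2 := (abs_le.1 (hM₁ w hw)).1
      have := le_max_left M₁ M₂
      change L w ≤ u n w at h1
      linarith
    · exact (hle n w (hsph hw)).trans (((abs_le.1 (hM₂ w hw)).2).trans (le_max_right _ _))
  have hWm : Measurable fun θ ↦ W (circleMap p ρ θ) :=
    measurable_of_tendsto_metrizable (fun n ↦ (hcirc n).measurable) (tendsto_pi_nhds.2 hlimθ)
  have hWb : ∀ θ, ‖W (circleMap p ρ θ)‖ ≤ max M₁ M₂ := fun θ ↦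
    le_of_tendsto (hlimθ θ).norm (Eventually.of_forall fun n ↦ hbound n _ (hmem θ))
  -- So far `W` is only a bounded pointwise limit on the circle; its continuity follows from the
  -- Poisson formula below.
  have hWi : CircleIntegrable W p ρ := by
    rw [CircleIntegrable, intervalIntegrable_iff]
    exact MeasureTheory.Measure.integrableOn_of_bounded
      (by rw [uIoc_of_le (by positivity)]; exact measure_Ioc_lt_top.ne) hWm.aestronglyMeasurable
      (Eventually.of_forall hWb)
  have hP : ∀ w ∈ ball p ρ, W w = poissonIntegral W p ρ w := by
    intro w hw
    have h1 : Tendsto (fun n ↦ poissonIntegral (u n) p ρ w) atTop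
        (𝓝 (poissonIntegral W p ρ w)) := by
      simp only [poissonIntegral, circleAverage_def, smul_eq_mul, Pi.mul_apply]
      refine Tendsto.const_mul _ ?_
      have hk : Continuous fun θ ↦ poissonKernel p w (circleMap p ρ θ) :=
        continuousOn_univ.1 ((continuousOn_poissonKernel hw).comp
          (continuous_circleMap p ρ).continuousOn fun θ _ ↦ hmem θ)
      refine intervalIntegral.tendsto_integral_filter_of_dominated_convergence
        (fun θ ↦ poissonKernel p w (circleMap p ρ θ) * max M₁ M₂) ?_ ?_ ?_ ?_
      · exact Eventually.of_forall fun n ↦ (hk.mul (hcirc n)).aestronglyMeasurable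
      · refine Eventually.of_forall fun n ↦ Eventually.of_forall fun θ _ ↦ ?_
        rw [norm_mul, Real.norm_of_nonneg (poissonKernel_nonneg_of_mem hw (hmem θ))]
        exact mul_le_mul_of_nonneg_left (hbound n _ (hmem θ))
          (poissonKernel_nonneg_of_mem hw (hmem θ))
      · exact (hk.mul continuous_const).intervalIntegrable _ _
      · exact Eventually.of_forall fun θ _ ↦ (hlimθ θ).const_mul _
    have hwΩ : w ∈ Ω := (hB₀ k).2 (ball_subset_closedBall hw)
    -- Just after each visit to disc `k`, the iterate there is the Poisson integral of its
    -- predecessor. Both sides converge along these indices, by monotonicity and dominated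
    -- convergence respectively.
    have hsub : Tendsto (fun m ↦ Nat.pair k m) atTop atTop :=
      tendsto_atTop_mono (fun m ↦ Nat.right_le_pair k m) tendsto_id
    have h2 : Tendsto (fun m ↦ u (Nat.pair k m + 1) w) atTop (𝓝 (W w)) :=
      (hlim w hwΩ).comp ((tendsto_add_atTop_nat 1).comp hsub)
    have h3 : ∀ m, u (Nat.pair k m + 1) w = poissonIntegral (u (Nat.pair k m)) p ρ w := by
      intro m
      have e1 : c (Nat.pair k m) = p := by simp [c, p]
      have e2 : R (Nat.pair k m) = ρ := by simp [R, ρ]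
      rw [hus, e1, e2, poissonLift_of_mem hw]
    simp only [h3] at h2
    exact tendsto_nhds_unique h2 (h1.comp hsub)
  refine (harmonicAt_congr_nhds ?_).2 (poissonIntegral_harmonicOnNhd hWi z hk)
  filter_upwards [isOpen_ball.mem_nhds hk] with w hw using hP w hw

/-! ### The domain `P_1` and its barriers -/

lemma normSq_sub_center (z : ℂ) :
    ‖z - ⟨1, 1⟩‖ ^ 2 = (z.re - 1) ^ 2 + (z.im - 1) ^ 2 := by
  rw [← Complex.normSq_eq_norm_sq, Complex.normSq_apply]
  simp; ring

lemma norm_sq_eq_re_im (z : ℂ) : ‖z‖ ^ 2 = z.re ^ 2 + z.im ^ 2 := by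
  rw [← Complex.normSq_eq_norm_sq, Complex.normSq_apply]; ring

lemma mem_cellDomain_one {z : ℂ} :
    z ∈ cellDomain 1 ↔ (0 < z.re ∧ 0 < z.im) ∧ 1 < ‖z - ⟨1, 1⟩‖ := by
  simp [cellDomain, quadrant, hole, dist_eq_norm]

lemma isOpen_quadrant : IsOpen quadrant :=
  (isOpen_lt continuous_const Complex.continuous_re).inter
    (isOpen_lt continuous_const Complex.continuous_im)

lemma isOpen_cellDomain (a : ℝ) : IsOpen (cellDomain a) :=
  isOpen_quadrant.sdiff isClosed_closedBall

lemma closure_quadrant_subset : closure quadrant ⊆ {z | 0 ≤ z.re ∧ 0 ≤ z.im} :=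
  closure_minimal (fun _ hz ↦ ⟨hz.1.le, hz.2.le⟩)
    ((isClosed_le continuous_const Complex.continuous_re).inter
      (isClosed_le continuous_const Complex.continuous_im))

lemma mem_closure_cellDomain_one {z : ℂ} (hz : z ∈ closure (cellDomain 1)) :
    (0 ≤ z.re ∧ 0 ≤ z.im) ∧ 1 ≤ ‖z - ⟨1, 1⟩‖ := by
  have h1 : closure (cellDomain 1) ⊆ {z | (0 ≤ z.re ∧ 0 ≤ z.im) ∧ 1 ≤ ‖z - ⟨1, 1⟩‖} := by
    refine closure_minimal (fun w hw ↦ ?_) ?_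
    · rw [mem_cellDomain_one] at hw
      exact ⟨⟨hw.1.1.le, hw.1.2.le⟩, hw.2.le⟩
    · exact ((isClosed_le continuous_const Complex.continuous_re).inter
        (isClosed_le continuous_const Complex.continuous_im)).inter
        (isClosed_le continuous_const (continuous_norm.comp (continuous_id.sub continuous_const)))
  exact h1 hz

lemma boundary_cellDomain_one {z : ℂ} (hz : z ∈ closure (cellDomain 1)) (hz' : z ∉ cellDomain 1) :
    z.re * z.im = 0 ∨ ‖z - ⟨1, 1⟩‖ = 1 := by
  obtain ⟨⟨h1, h2⟩, h3⟩ := mem_closure_cellDomain_one hz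
  by_contra! h
  refine hz' (mem_cellDomain_one.2 ⟨⟨?_, ?_⟩, lt_of_le_of_ne h3 (Ne.symm h.2)⟩)
  · exact lt_of_le_of_ne h1 fun e ↦ h.1 (by simp [← e])
  · exact lt_of_le_of_ne h2 fun e ↦ h.1 (by simp [← e])

lemma harmonicAt_re_mul_im (z : ℂ) : HarmonicAt (fun z : ℂ ↦ z.re * z.im) z := by
  have h : AnalyticAt ℂ (fun z : ℂ ↦ z ^ 2 / 2) z := by fun_prop
  refine (harmonicAt_congr_nhds (Eventually.of_forall fun w ↦ ?_)).1 h.harmonicAt_im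
  have : w ^ 2 / 2 = ((w.re * w.re - w.im * w.im) / 2 : ℝ) + (w.re * w.im : ℝ) * Complex.I := by
    apply Complex.ext <;> simp [pow_two] ; ring
  simp [this]

lemma harmonicAt_re_mul_im_div {z : ℂ} (hz : z ≠ 0) :
    HarmonicAt (fun z : ℂ ↦ z.re * z.im / (‖z‖ ^ 2) ^ 2) z := by
  have h : AnalyticAt ℂ (fun z : ℂ ↦ -(z⁻¹) ^ 2 / 2) z := by fun_prop (disch := assumption)
  refine (harmonicAt_congr_nhds (Eventually.of_forall fun w ↦ ?_)).1 h.harmonicAt_im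
  have : -(w⁻¹) ^ 2 / 2 = ((-1 / 2 : ℝ) : ℂ) * (w⁻¹ * w⁻¹) := by push_cast; ring
  simp only [this]
  rw [Complex.im_ofReal_mul, Complex.mul_im, Complex.inv_re, Complex.inv_im,
    Complex.normSq_eq_norm_sq]
  ring

/-- A subsolution off the hole that agrees with `s t` on its boundary. -/
noncomputable def holeBarrier (z : ℂ) : ℝ :=
  (1 + (z.re - 1) / ‖z - ⟨1, 1⟩‖ ^ 2) * (1 + (z.im - 1) / ‖z - ⟨1, 1⟩‖ ^ 2) -
    4 * Real.log ‖z - ⟨1, 1⟩‖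

lemma harmonicAt_holeBarrier {z : ℂ} (hz : z ≠ ⟨1, 1⟩) : HarmonicAt holeBarrier z := by
  have hz' : z - ⟨1, 1⟩ ≠ 0 := sub_ne_zero.2 hz
  have h1 : HarmonicAt (fun z : ℂ ↦ (1 + (z.re - 1) / ‖z - ⟨1, 1⟩‖ ^ 2) *
      (1 + (z.im - 1) / ‖z - ⟨1, 1⟩‖ ^ 2)) z := by
    have h : AnalyticAt ℂ (fun z : ℂ ↦ -((⟨1, -1⟩ : ℂ) + (z - ⟨1, 1⟩)⁻¹) ^ 2 / 2) z := by
      fun_prop (disch := assumption)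
    refine (harmonicAt_congr_nhds (Eventually.of_forall fun w ↦ ?_)).1 h.harmonicAt_im
    have : -((⟨1, -1⟩ : ℂ) + (w - ⟨1, 1⟩)⁻¹) ^ 2 / 2 = ((-1 / 2 : ℝ) : ℂ) *
        (((⟨1, -1⟩ : ℂ) + (w - ⟨1, 1⟩)⁻¹) * ((⟨1, -1⟩ : ℂ) + (w - ⟨1, 1⟩)⁻¹)) := by
      push_cast; ring
    simp only [this]
    rw [Complex.im_ofReal_mul, Complex.mul_im, Complex.add_re, Complex.add_im, Complex.inv_re,
      Complex.inv_im, Complex.normSq_eq_norm_sq, Complex.sub_re, Complex.sub_im]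
    ring
  have h2 : HarmonicAt (fun z : ℂ ↦ Real.log ‖z - ⟨1, 1⟩‖) z :=
    AnalyticAt.harmonicAt_log_norm (f := fun z : ℂ ↦ z - ⟨1, 1⟩) (by fun_prop) hz'
  exact h1.sub (h2.const_smul (c := (4 : ℝ)))

lemma holeBarrier_eq {z : ℂ} (hz : ‖z - ⟨1, 1⟩‖ = 1) : holeBarrier z = z.re * z.im := by
  simp [holeBarrier, hz]

/-- With `q = r²`, `x = s - 1`, `y = t - 1`, the difference between `s t` and its reflection in the
circle factors as `(1 - 1/q)((1 + x)(1 + y) - 1 + x y / q)`. The second factor is at least `-3/2` in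
the quadrant, and the logarithmic term `2 log q ≥ 2 (1 - 1/q)` makes up for it. -/
lemma holeBarrier_le {z : ℂ} (hz : z ∈ cellDomain 1) : holeBarrier z ≤ z.re * z.im := by
  obtain ⟨⟨h1, h2⟩, h3⟩ := mem_cellDomain_one.1 hz
  have hr := normSq_sub_center z
  have hlog : 4 * Real.log ‖z - ⟨1, 1⟩‖ = 2 * Real.log (‖z - ⟨1, 1⟩‖ ^ 2) := by
    rw [Real.log_pow]; push_cast; ring
  have hq1 : 1 < ‖z - ⟨1, 1⟩‖ ^ 2 := by nlinarith
  rw [holeBarrier, hlog]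
  set q := ‖z - ⟨1, 1⟩‖ ^ 2
  have hq : 0 < q := by linarith
  have hl : 1 - 1 / q ≤ Real.log q := by
    have := Real.one_sub_inv_le_log_of_pos hq
    simpa using this
  set x := z.re - 1 with hx
  set y := z.im - 1 with hy
  have hre : z.re = 1 + x := by rw [hx]; ring
  have him : z.im = 1 + y := by rw [hy]; ring
  rw [hre] at h1 ⊢
  rw [him] at h2 ⊢
  have hxy : -(1 / 2) ≤ x * y / q := by
    rw [le_div_iff₀ hq]; nlinarith [sq_nonneg (x + y)]
  have h4 : 0 < (1 + x) * (1 + y) := mul_pos h1 h2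
  have hp : 0 ≤ 1 - 1 / q := by
    rw [sub_nonneg, div_le_one hq]; exact hq1.le
  have e : (1 + x) * (1 + y) - (1 + x / q) * (1 + y / q) =
      (1 - 1 / q) * ((1 + x) * (1 + y) - 1 + x * y / q) := by
    field_simp; ring
  have := mul_le_mul_of_nonneg_left (show -(3 / 2) ≤ (1 + x) * (1 + y) - 1 + x * y / q by linarith) hp
  linarith

/-- For `r ≥ 2` each factor of the reflected product has absolute value at most `3/2`, and `9/4 < 4
log 2`. -/
lemma holeBarrier_nonpos {z : ℂ} (hz : 2 ≤ ‖z - ⟨1, 1⟩‖) : holeBarrier z ≤ 0 := by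
  have hr := normSq_sub_center z
  have hlog : 4 * Real.log ‖z - ⟨1, 1⟩‖ = 2 * Real.log (‖z - ⟨1, 1⟩‖ ^ 2) := by
    rw [Real.log_pow]; push_cast; ring
  have hq1 : 4 ≤ ‖z - ⟨1, 1⟩‖ ^ 2 := by nlinarith
  rw [holeBarrier, hlog]
  set q := ‖z - ⟨1, 1⟩‖ ^ 2
  have hq : 0 < q := by linarith
  have hl : 2 * Real.log 2 ≤ Real.log q := by
    have : Real.log 4 = 2 * Real.log 2 := by
      rw [show (4 : ℝ) = 2 ^ 2 by norm_num, Real.log_pow]; norm_num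
    rw [← this]; exact Real.log_le_log (by norm_num) hq1
  have := Real.log_two_gt_d9
  have hp : ∀ a : ℝ, a ^ 2 ≤ q → |1 + a / q| ≤ 3 / 2 := fun a ha ↦ by
    have h : (a / q) ^ 2 ≤ (1 / 2) ^ 2 := by
      rw [div_pow, div_le_iff₀ (by positivity)]; nlinarith
    have := abs_le_of_sq_le_sq' h (by norm_num)
    rw [abs_le]; constructor <;> linarith
  have hK : (1 + (z.re - 1) / q) * (1 + (z.im - 1) / q) ≤ 3 / 2 * (3 / 2) := by
    refine (le_abs_self _).trans ?_
    rw [abs_mul]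
    exact mul_le_mul (hp _ (by nlinarith [sq_nonneg (z.im - 1)]))
      (hp _ (by nlinarith [sq_nonneg (z.re - 1)])) (abs_nonneg _) (by norm_num)
  linarith

/-- A function harmonic in `P_1`, with the boundary values of the cell function, that decays like
`s t / |z|⁴`. -/
theorem exists_harmonicContOnCl_cellDomain_one :
    ∃ W : ℂ → ℝ, HarmonicContOnCl W (cellDomain 1) ∧ (∀ z ∉ cellDomain 1, W z = z.re * z.im) ∧
      ∀ z ∈ cellDomain 1, 0 ≤ W z ∧ W z ≤ 256 * (z.re * z.im / (‖z‖ ^ 2) ^ 2) := by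
  classical
  have hΩ := isOpen_cellDomain 1
  have hne0 : ∀ z ∈ cellDomain 1, z ≠ 0 := fun z hz h ↦ by
    have := (mem_cellDomain_one.1 hz).1.1; simp [h] at this
  have hnec : ∀ z ∈ cellDomain 1, z ≠ ⟨1, 1⟩ := fun z hz h ↦ by
    have := (mem_cellDomain_one.1 hz).2; rw [h] at this; simp at this; linarith
  have hL : IsSubmean (fun z ↦ max 0 (holeBarrier z)) (cellDomain 1) :=
    (HarmonicOnNhd.isSubmean hΩ (harmonicOnNhd_const (0 : ℝ))).sup hΩ
      (HarmonicOnNhd.isSubmean hΩ fun z hz ↦ harmonicAt_holeBarrier (hnec z hz))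
  have hU : IsSubmean (fun z ↦ -min (z.re * z.im) (256 * (z.re * z.im / (‖z‖ ^ 2) ^ 2)))
      (cellDomain 1) := by
    have h1 : HarmonicOnNhd (-fun z : ℂ ↦ z.re * z.im) (cellDomain 1) :=
      HarmonicOnNhd.neg fun z _ ↦ harmonicAt_re_mul_im z
    have h2 : HarmonicOnNhd (-fun z : ℂ ↦ 256 * (z.re * z.im / (‖z‖ ^ 2) ^ 2)) (cellDomain 1) :=
      HarmonicOnNhd.neg fun z hz ↦ (harmonicAt_re_mul_im_div (hne0 z hz)).const_smul (c := (256 : ℝ))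
    have := (h1.isSubmean hΩ).sup hΩ (h2.isSubmean hΩ)
    simpa only [Pi.neg_apply, max_neg_neg] using this
  obtain ⟨w, hw, hb⟩ := exists_harmonicOnNhd_between hΩ hL hU fun z hz ↦ by
    obtain ⟨⟨h1, h2⟩, h3⟩ := mem_cellDomain_one.1 hz
    have hu : 0 < z.re * z.im := mul_pos h1 h2
    have hz0 : 0 < ‖z‖ ^ 2 := by have := norm_pos_iff.2 (hne0 z hz); positivity
    refine max_le (le_min hu.le (by positivity)) ?_
    -- The constant `256 = 16²` is chosen so that the decaying barrier dominates `s t` for `|z| ≤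
    -- 4`. Beyond that, `r ≥ 2` and the lower barrier is zero.
    rcases le_or_gt (‖z‖ ^ 2) 16 with h | h
    · refine le_min (holeBarrier_le hz) ((holeBarrier_le hz).trans ?_)
      rw [mul_div_assoc', le_div_iff₀ (by positivity)]
      have : (‖z‖ ^ 2) ^ 2 ≤ 256 := by nlinarith
      nlinarith
    · have : 2 ≤ ‖z - ⟨1, 1⟩‖ := by
        have hr := normSq_sub_center z
        have hr' := norm_sq_eq_re_im z
        nlinarith [norm_nonneg (z - ⟨1, 1⟩), sq_nonneg (z.re - z.im), sq_nonneg (z.re + z.im - 4)]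
      have := holeBarrier_nonpos this
      exact this.trans (le_min hu.le (by positivity))
  set W : ℂ → ℝ := fun z ↦ if z ∈ cellDomain 1 then w z else z.re * z.im
  have hWin : ∀ z ∈ cellDomain 1, W z = w z := fun z hz ↦ if_pos hz
  have hWout : ∀ z ∉ cellDomain 1, W z = z.re * z.im := fun z hz ↦ if_neg hz
  have hharm : HarmonicOnNhd W (cellDomain 1) := fun z hz ↦ by
    refine (harmonicAt_congr_nhds ?_).2 (hw z hz)
    filter_upwards [hΩ.mem_nhds hz] with y hy using hWin y hy
  refine ⟨W, ⟨hharm, fun z hz ↦ ?_⟩, hWout, fun z hz ↦ ?_⟩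
  swap
  · rw [hWin z hz]
    exact ⟨(le_max_left _ _).trans (hb z hz).1, (hb z hz).2.trans (min_le_right _ _)⟩
  by_cases hzP : z ∈ cellDomain 1
  · exact (hharm z hzP).1.continuousAt.continuousWithinAt
  have hcl := mem_closure_cellDomain_one hz
  have huc : Continuous fun z : ℂ ↦ z.re * z.im := by fun_prop
  have hbd := boundary_cellDomain_one hz hzP
  have hzc : z ≠ ⟨1, 1⟩ := fun h ↦ by
    have := hcl.2; rw [h] at this; simp at this; linarith
  -- Squeeze: `W` lies between this function and `s t` everywhere, and the two agree at `z`. On the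
  -- axes both vanish; on the circle `holeBarrier` equals `s t`.
  have hlow : ContinuousAt (fun z ↦ min (z.re * z.im) (max 0 (holeBarrier z))) z :=
    huc.continuousAt.min (continuousAt_const.max (harmonicAt_holeBarrier hzc).1.continuousAt)
  have hlowz : min (z.re * z.im) (max 0 (holeBarrier z)) = z.re * z.im := by
    rcases hbd with h | h
    · rw [h]; exact min_eq_left (le_max_left _ _)
    · rw [holeBarrier_eq h]; exact min_eq_left (le_max_right _ _)
  rw [ContinuousWithinAt, hWout z hzP]
  rw [ContinuousAt, hlowz] at hlow
  refine tendsto_of_tendsto_of_tendsto_of_le_of_le (hlow.mono_left nhdsWithin_le_nhds)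
    (huc.continuousAt.tendsto.mono_left nhdsWithin_le_nhds) (fun y ↦ ?_) (fun y ↦ ?_)
  · by_cases hy : y ∈ cellDomain 1
    · simp only [hWin y hy]; exact (min_le_right _ _).trans (hb y hy).1
    · simp only [hWout y hy]; exact min_le_left _ _
  · by_cases hy : y ∈ cellDomain 1
    · simp only [hWin y hy]; exact (hb y hy).2.trans (min_le_left _ _)
    · simp only [hWout y hy]; exact le_rfl

/-! ### Gradients and weak harmonicity -/

open MeasureTheory

/-- The pointwise inner product `∇f · ∇g`. -/
noncomputable def gradInner (f g : ℂ → ℝ) (z : ℂ) : ℝ :=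
  fderiv ℝ f z 1 * fderiv ℝ g z 1 + fderiv ℝ f z Complex.I * fderiv ℝ g z Complex.I

lemma norm_gradient_sq (f : ℂ → ℝ) (z : ℂ) : ‖gradient f z‖ ^ 2 = gradInner f f z := by
  have h : ∀ v, inner ℝ (gradient f z) v = fderiv ℝ f z v := fun v ↦ by
    simp [gradient]
  rw [norm_sq_eq_re_im, gradInner, ← h 1, ← h Complex.I, Complex.inner, Complex.inner]
  simp; ring

lemma gradInner_self_nonneg (f : ℂ → ℝ) (z : ℂ) : 0 ≤ gradInner f f z :=
  add_nonneg (mul_self_nonneg _) (mul_self_nonneg _)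

lemma gradInner_comm (f g : ℂ → ℝ) (z : ℂ) : gradInner f g z = gradInner g f z := by
  simp only [gradInner]; ring

lemma two_mul_gradInner_le (f g : ℂ → ℝ) (z : ℂ) :
    2 * gradInner f g z ≤ gradInner f f z + gradInner g g z := by
  simp only [gradInner]
  nlinarith [sq_nonneg (fderiv ℝ f z 1 - fderiv ℝ g z 1),
    sq_nonneg (fderiv ℝ f z Complex.I - fderiv ℝ g z Complex.I)]

lemma abs_gradInner_le (f g : ℂ → ℝ) (z : ℂ) {δ : ℝ} (hδ : 0 < δ) :
    |gradInner f g z| ≤ (δ * gradInner f f z + δ⁻¹ * gradInner g g z) / 2 := by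
  simp only [gradInner]
  set a := fderiv ℝ f z 1
  set b := fderiv ℝ f z Complex.I
  set c := fderiv ℝ g z 1
  set d := fderiv ℝ g z Complex.I
  have e : δ * δ⁻¹ = 1 := mul_inv_cancel₀ hδ.ne'
  have hi : 0 < δ⁻¹ := inv_pos.2 hδ
  have key : ∀ x y : ℝ, x * y ≤ (δ * (x * x) + δ⁻¹ * (y * y)) / 2 := fun x y ↦ by
    have : 0 ≤ δ⁻¹ * (δ * x - y) ^ 2 := by positivity
    have e2 : δ⁻¹ * (δ * x - y) ^ 2 = δ * (x * x) - 2 * (x * y) + δ⁻¹ * (y * y) := by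
      linear_combination (δ * x ^ 2 - 2 * x * y) * e
    linarith
  rw [abs_le]
  constructor
  · linarith [key (-a) c, key (-b) d]
  · linarith [key a c, key b d]

/-- `∂ₓW - i ∂ᵧW` is holomorphic, and one of its Cauchy–Riemann equations is the vanishing of the
Laplacian, in the form needed for integration by parts. -/
lemma fderiv_fderiv_add_eq_zero {W : ℂ → ℝ} {z : ℂ} (hW : HarmonicAt W z) :
    fderiv ℝ (fun z ↦ fderiv ℝ W z 1) z 1 +
      fderiv ℝ (fun z ↦ fderiv ℝ W z Complex.I) z Complex.I = 0 := by
  have h := (_root_.HarmonicAt.differentiableAt_complex_partial hW).hasDerivAt.hasFDerivAt.restrictScalars ℝ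
  set h' := deriv (fun z ↦ ((fderiv ℝ W z 1 : ℝ) : ℂ) -
    Complex.I * ((fderiv ℝ W z Complex.I : ℝ) : ℂ)) z
  have h1 := (Complex.reCLM.hasFDerivAt.comp z h).fderiv
  have h2 := ((-Complex.imCLM).hasFDerivAt.comp z h).fderiv
  have e1 : (⇑Complex.reCLM ∘ fun z ↦ ((fderiv ℝ W z 1 : ℝ) : ℂ) -
      Complex.I * ((fderiv ℝ W z Complex.I : ℝ) : ℂ)) = fun z ↦ fderiv ℝ W z 1 := by
    funext w; simp
  have e2 : (⇑(-Complex.imCLM) ∘ fun z ↦ ((fderiv ℝ W z 1 : ℝ) : ℂ) -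
      Complex.I * ((fderiv ℝ W z Complex.I : ℝ) : ℂ)) = fun z ↦ fderiv ℝ W z Complex.I := by
    funext w; simp
  rw [e1] at h1
  rw [e2] at h2
  rw [h1, h2]
  simp

lemma contDiffAt_fderiv_apply {W : ℂ → ℝ} {z : ℂ} (hW : HarmonicAt W z) (v : ℂ) :
    ContDiffAt ℝ 1 (fun z ↦ fderiv ℝ W z v) z :=
  (hW.1.fderiv_right (m := 1) (by norm_num)).clm_apply contDiffAt_const

lemma continuous_mul_of_tsupport_subset {a b : ℂ → ℝ} {Ω : Set ℂ} (hΩ : IsOpen Ω)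
    (ha : ContinuousOn a Ω) (hb : Continuous b) (hs : tsupport b ⊆ Ω) :
    Continuous fun z ↦ a z * b z :=
  (ha.mul hb.continuousOn).continuous_of_tsupport_subset hΩ
    ((closure_mono (Function.support_mul_subset_right a b)).trans hs)

/-- Harmonic functions are weakly harmonic. -/
theorem integrable_gradInner_and_integral_eq_zero {W η : ℂ → ℝ} {Ω : Set ℂ} (hΩ : IsOpen Ω)
    (hW : HarmonicOnNhd W Ω) (hη : ContDiff ℝ 1 η) (hc : HasCompactSupport η)
    (hs : tsupport η ⊆ Ω) :
    Integrable (fun z ↦ gradInner η W z) ∧ ∫ z, gradInner η W z = 0 := by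
  have hηv : ∀ v, Continuous fun z ↦ fderiv ℝ η z v := fun v ↦
    (hη.continuous_fderiv one_ne_zero).clm_apply continuous_const
  have hp : ∀ v, ContDiffOn ℝ 1 (fun z ↦ fderiv ℝ W z v) Ω := fun v z hz ↦
    (contDiffAt_fderiv_apply (hW z hz) v).contDiffWithinAt
  have hpp : ∀ v, ContinuousOn (fun z ↦ fderiv ℝ (fun z ↦ fderiv ℝ W z v) z v) Ω := fun v ↦
    ((hp v).continuousOn_fderiv_of_isOpen hΩ le_rfl).clm_apply continuousOn_const
  have i1 : ∀ v, Integrable fun z ↦ fderiv ℝ (fun z ↦ fderiv ℝ W z v) z v * η z := fun v ↦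
    (continuous_mul_of_tsupport_subset hΩ (hpp v) hη.continuous hs).integrable_of_hasCompactSupport
      hc.mul_left
  have hcv : ∀ v, HasCompactSupport fun z ↦ fderiv ℝ η z v := fun v ↦
    hc.of_isClosed_subset (isClosed_tsupport _) (tsupport_fderiv_apply_subset ℝ v)
  have i2 : ∀ v, Integrable fun z ↦ fderiv ℝ W z v * fderiv ℝ η z v := fun v ↦
    (continuous_mul_of_tsupport_subset hΩ (hp v).continuousOn (hηv v)
      ((tsupport_fderiv_apply_subset ℝ v).trans hs)).integrable_of_hasCompactSupport (hcv v).mul_left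
  have i3 : ∀ v, Integrable fun z ↦ fderiv ℝ W z v * η z := fun v ↦
    (continuous_mul_of_tsupport_subset hΩ (hp v).continuousOn hη.continuous
      hs).integrable_of_hasCompactSupport hc.mul_left
  have hI : ∀ v, ∫ z, fderiv ℝ W z v * fderiv ℝ η z v =
      -∫ z, fderiv ℝ (fun z ↦ fderiv ℝ W z v) z v * η z := fun v ↦
    integral_mul_fderiv_eq_neg_fderiv_mul_of_integrable (i1 v) (i2 v) (i3 v)
      (fun z hz ↦ (contDiffAt_fderiv_apply (hW z (hs hz)) v).differentiableAt one_ne_zero)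
      (fun z _ ↦ (hη.differentiable one_ne_zero) z)
  have e : (fun z ↦ gradInner η W z) = fun z ↦ fderiv ℝ W z 1 * fderiv ℝ η z 1 +
      fderiv ℝ W z Complex.I * fderiv ℝ η z Complex.I := by
    funext z; simp only [gradInner]; ring
  rw [e]
  refine ⟨(i2 1).add (i2 Complex.I), ?_⟩
  rw [integral_add (i2 1) (i2 Complex.I), hI, hI, ← neg_add, ← integral_add (i1 1) (i1 Complex.I),
    neg_eq_zero]
  refine integral_eq_zero_of_ae (Eventually.of_forall fun z ↦ ?_)
  by_cases hz : z ∈ tsupport η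
  · have := fderiv_fderiv_add_eq_zero (hW z (hs hz))
    simp only [← add_mul, this, zero_mul, Pi.zero_apply]
  · simp [image_eq_zero_of_notMem_tsupport hz]

/-! ### Truncated test functions -/

open Classical in
/-- `f` on `Ω`, extended by zero. -/
noncomputable def zeroExtend (Ω : Set ℂ) (f : ℂ → ℝ) (z : ℂ) : ℝ := if z ∈ Ω then f z else 0

lemma zeroExtend_of_mem {Ω : Set ℂ} {f : ℂ → ℝ} {z : ℂ} (hz : z ∈ Ω) :
    zeroExtend Ω f z = f z := if_pos hz

lemma zeroExtend_of_notMem {Ω : Set ℂ} {f : ℂ → ℝ} {z : ℂ} (hz : z ∉ Ω) :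
    zeroExtend Ω f z = 0 := if_neg hz

section Truncation

variable {Ω : Set ℂ} {D : ℂ → ℝ} {ψ : ℝ → ℝ} {δ : ℝ}

lemma isClosed_superlevel (hc : ContinuousOn D (closure Ω)) :
    IsClosed {z | z ∈ closure Ω ∧ δ ≤ |D z|} :=
  hc.abs.preimage_isClosed_of_isClosed isClosed_closure isClosed_Ici

lemma superlevel_subset (hδ : 0 < δ) (h0 : ∀ z ∈ closure Ω, z ∉ Ω → D z = 0) :
    {z | z ∈ closure Ω ∧ δ ≤ |D z|} ⊆ Ω := fun z hz ↦ by
  by_contra h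
  have := hz.2
  rw [h0 z hz.1 h, abs_zero] at this
  linarith

lemma tsupport_zeroExtend_subset (hc : ContinuousOn D (closure Ω))
    (hψ : ∀ x, |x| ≤ δ → ψ x = 0) :
    tsupport (zeroExtend Ω (ψ ∘ D)) ⊆ {z | z ∈ closure Ω ∧ δ ≤ |D z|} := by
  refine closure_minimal (fun z hz ↦ ?_) (isClosed_superlevel hc)
  by_cases hzΩ : z ∈ Ω
  · rw [Function.mem_support, zeroExtend_of_mem hzΩ] at hz
    refine ⟨subset_closure hzΩ, ?_⟩
    by_contra! h
    exact hz (hψ _ h.le)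
  · exact absurd (zeroExtend_of_notMem hzΩ) hz

/-- Because `ψ` vanishes on `[-δ, δ]` and `D` vanishes on the boundary, the support stays in a
closed subset of `Ω`. Extension by zero is thus smooth across the boundary, however irregular that
is. -/
lemma contDiff_zeroExtend (hΩ : IsOpen Ω) (hD : ContDiffOn ℝ 1 D Ω)
    (hc : ContinuousOn D (closure Ω)) (h0 : ∀ z ∈ closure Ω, z ∉ Ω → D z = 0)
    (hδ : 0 < δ) (hψ1 : ContDiff ℝ 1 ψ) (hψ : ∀ x, |x| ≤ δ → ψ x = 0) :
    ContDiff ℝ 1 (zeroExtend Ω (ψ ∘ D)) := by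
  rw [contDiff_iff_contDiffAt]
  intro z
  by_cases hz : z ∈ Ω
  · have : ContDiffAt ℝ 1 (ψ ∘ D) z :=
      hψ1.contDiffAt.comp z ((hD z hz).contDiffAt (hΩ.mem_nhds hz))
    refine this.congr_of_eventuallyEq ?_
    filter_upwards [hΩ.mem_nhds hz] with w hw using zeroExtend_of_mem hw
  · refine contDiffAt_const (c := (0 : ℝ)) |>.congr_of_eventuallyEq ?_
    have : z ∉ tsupport (zeroExtend Ω (ψ ∘ D)) := fun h ↦
      hz (superlevel_subset hδ h0 (tsupport_zeroExtend_subset hc hψ h))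
    exact notMem_tsupport_iff_eventuallyEq.1 this

lemma fderiv_zeroExtend (hΩ : IsOpen Ω) (hD : ContDiffOn ℝ 1 D Ω) (hψ1 : ContDiff ℝ 1 ψ)
    {z : ℂ} (hz : z ∈ Ω) (v : ℂ) :
    fderiv ℝ (zeroExtend Ω (ψ ∘ D)) z v = deriv ψ (D z) * fderiv ℝ D z v := by
  have h1 : zeroExtend Ω (ψ ∘ D) =ᶠ[𝓝 z] ψ ∘ D := by
    filter_upwards [hΩ.mem_nhds hz] with w hw using zeroExtend_of_mem hw
  have h2 : DifferentiableAt ℝ D z :=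
    ((hD z hz).contDiffAt (hΩ.mem_nhds hz)).differentiableAt one_ne_zero
  have h3 := ((hψ1.differentiable one_ne_zero) (D z)).hasDerivAt.comp_hasFDerivAt z h2.hasFDerivAt
  rw [h1.fderiv_eq, h3.fderiv]
  simp

lemma gradInner_zeroExtend (hΩ : IsOpen Ω) (hD : ContDiffOn ℝ 1 D Ω) (hψ1 : ContDiff ℝ 1 ψ)
    (g : ℂ → ℝ) {z : ℂ} (hz : z ∈ Ω) :
    gradInner (zeroExtend Ω (ψ ∘ D)) g z = deriv ψ (D z) * gradInner D g z := by
  simp only [gradInner, fderiv_zeroExtend hΩ hD hψ1 hz]; ring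

lemma fderiv_zeroExtend_of_notMem (hc : ContinuousOn D (closure Ω))
    (h0 : ∀ z ∈ closure Ω, z ∉ Ω → D z = 0) (hδ : 0 < δ) (hψ : ∀ x, |x| ≤ δ → ψ x = 0)
    {z : ℂ} (hz : z ∉ Ω) : fderiv ℝ (zeroExtend Ω (ψ ∘ D)) z = 0 := by
  have : z ∉ tsupport (zeroExtend Ω (ψ ∘ D)) := fun h ↦
      hz (superlevel_subset hδ h0 (tsupport_zeroExtend_subset hc hψ h))
  rw [(notMem_tsupport_iff_eventuallyEq.1 this).fderiv_eq]
  simp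

end Truncation

/-- A continuous function vanishing on `[-1/n, 1/n]` and increasing to `1` off `0`. -/
noncomputable def cutSlope (n : ℕ) (t : ℝ) : ℝ := min 1 (max 0 (n * |t| - 1))

/-- The `C¹` truncation with slope `cutSlope n`. -/
noncomputable def cut (n : ℕ) (x : ℝ) : ℝ := ∫ t in (0 : ℝ)..x, cutSlope n t

lemma continuous_cutSlope (n : ℕ) : Continuous (cutSlope n) := by
  unfold cutSlope; fun_prop

lemma cutSlope_nonneg (n : ℕ) (t : ℝ) : 0 ≤ cutSlope n t := le_min zero_le_one (le_max_left _ _)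

lemma cutSlope_le_one (n : ℕ) (t : ℝ) : cutSlope n t ≤ 1 := min_le_left _ _

lemma cutSlope_zero (n : ℕ) : cutSlope n 0 = 0 := by simp [cutSlope]

lemma hasDerivAt_cut (n : ℕ) (x : ℝ) : HasDerivAt (cut n) (cutSlope n x) x :=
  intervalIntegral.integral_hasDerivAt_right ((continuous_cutSlope n).intervalIntegrable _ _)
    ((continuous_cutSlope n).stronglyMeasurableAtFilter _ _) (continuous_cutSlope n).continuousAt

lemma deriv_cut (n : ℕ) : deriv (cut n) = cutSlope n := funext fun x ↦ (hasDerivAt_cut n x).deriv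

lemma contDiff_cut (n : ℕ) : ContDiff ℝ 1 (cut n) :=
  contDiff_one_iff_deriv.2 ⟨fun x ↦ (hasDerivAt_cut n x).differentiableAt, by
    rw [deriv_cut]; exact continuous_cutSlope n⟩

lemma cut_eq_zero {n : ℕ} (x : ℝ) (hx : |x| ≤ 1 / n) : cut n x = 0 := by
  -- For `n = 0` the bound `1 / n` is `0`, so `x = 0`.
  rcases n.eq_zero_or_pos with rfl | hn
  · simp at hx; simp [hx, cut]
  have hn' : (0 : ℝ) < n := by exact_mod_cast hn
  rw [cut]
  refine intervalIntegral.integral_zero_ae (Eventually.of_forall fun t ht ↦ ?_)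
  have h1 : |t| ≤ |x| := by
    rcases mem_uIoc.1 ht with h | h
    · rw [abs_of_pos h.1, abs_of_pos (h.1.trans_le h.2)]; exact h.2
    · rw [abs_of_nonpos h.2, abs_of_nonpos (h.1.le.trans h.2)]; linarith [h.1]
  have h2 : n * |t| - 1 ≤ 0 := by
    have := h1.trans hx
    rw [le_div_iff₀ hn'] at this; linarith
  simp [cutSlope, max_eq_left h2]

lemma tendsto_cutSlope {t : ℝ} (ht : t ≠ 0) :
    Tendsto (fun n ↦ cutSlope n t) atTop (𝓝 1) := by
  refine tendsto_const_nhds.congr' ?_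
  have : Tendsto (fun n : ℕ ↦ (n : ℝ) * |t|) atTop atTop :=
    tendsto_natCast_atTop_atTop.atTop_mul_const (abs_pos.2 ht)
  filter_upwards [this.eventually_ge_atTop 2] with n hn
  rw [cutSlope, min_eq_left]
  exact le_max_of_le_right (by linarith)

/-! ### Dirichlet's principle -/

lemma continuousOn_gradInner {f g : ℂ → ℝ} {Ω : Set ℂ} (hΩ : IsOpen Ω) (hf : ContDiffOn ℝ 1 f Ω)
    (hg : ContDiffOn ℝ 1 g Ω) : ContinuousOn (gradInner f g) Ω := by
  have h : ∀ {f : ℂ → ℝ} (_ : ContDiffOn ℝ 1 f Ω) (v : ℂ),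
      ContinuousOn (fun z ↦ fderiv ℝ f z v) Ω := fun hf v ↦
    (hf.continuousOn_fderiv_of_isOpen hΩ le_rfl).clm_apply continuousOn_const
  exact ((h hf 1).mul (h hg 1)).add ((h hf Complex.I).mul (h hg Complex.I))

lemma gradInner_sub_left {f g h : ℂ → ℝ} {z : ℂ} (hf : DifferentiableAt ℝ f z)
    (hg : DifferentiableAt ℝ g z) :
    gradInner (fun z ↦ f z - g z) h z = gradInner f h z - gradInner g h z := by
  simp only [gradInner, fderiv_fun_sub hf hg, sub_apply]
  ring

/-- On `s` the function is approximated by the zero map with constant `0`, and at almost every point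
of `s` this bounds the derivative. Values are cast to `ℂ` so that source and target of the
approximation coincide. -/
lemma ae_fderiv_eq_zero_of_eq_zero {D : ℂ → ℝ} {s : Set ℂ} (hs : MeasurableSet s)
    (hD : ∀ z ∈ s, DifferentiableAt ℝ D z) (h0 : ∀ z ∈ s, D z = 0) :
    ∀ᵐ z ∂volume.restrict s, fderiv ℝ D z = 0 := by
  have hA : ApproximatesLinearOn (fun z ↦ (D z : ℂ)) (0 : ℂ →L[ℝ] ℂ) s 0 := by
    intro x hx y hy
    simp [h0 x hx, h0 y hy]
  have := hA.norm_fderiv_sub_le volume hs (fun z ↦ Complex.ofRealCLM.comp (fderiv ℝ D z))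
    fun z hz ↦ (Complex.ofRealCLM.hasFDerivAt.comp z (hD z hz).hasFDerivAt).hasFDerivWithinAt
  filter_upwards [this] with z hz
  rw [sub_zero] at hz
  have h : Complex.ofRealCLM.comp (fderiv ℝ D z) = 0 := by
    rw [← nnnorm_eq_zero]; exact le_antisymm hz bot_le
  ext v
  have := congrArg (fun L : ℂ →L[ℝ] ℂ ↦ L v) h
  simpa using this

lemma integrableOn_and_setIntegral_le_of_lintegral_le {f : ℂ → ℝ} {s : Set ℂ} {C : ℝ}
    (hs : MeasurableSet s) (hf : ContinuousOn f s) (h0 : ∀ z, 0 ≤ f z) (hC : 0 ≤ C)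
    (h : ∫⁻ z in s, ENNReal.ofReal (f z) ≤ ENNReal.ofReal C) :
    IntegrableOn f s ∧ ∫ z in s, f z ≤ C := by
  have hm := hf.aestronglyMeasurable (μ := volume) hs
  refine ⟨⟨hm, ?_⟩, ?_⟩
  · rw [hasFiniteIntegral_iff_ofReal (Eventually.of_forall h0)]
    exact h.trans_lt ENNReal.ofReal_lt_top
  · rw [integral_eq_lintegral_of_nonneg_ae (Eventually.of_forall h0) hm]
    exact ENNReal.toReal_le_of_le_ofReal hC h

/-- **Dirichlet's principle.** -/
theorem dirichlet_principle {Ω : Set ℂ} {W V : ℂ → ℝ} (hΩ : IsOpen Ω) (hW : HarmonicOnNhd W Ω)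
    (hV : ContDiffOn ℝ 1 V Ω) (hc : ContinuousOn (fun z ↦ W z - V z) (closure Ω))
    (h0 : ∀ z ∈ closure Ω, z ∉ Ω → W z - V z = 0)
    (hinf : ∀ ε > 0, ∃ R, ∀ z ∈ closure Ω, ε ≤ |W z - V z| → ‖z‖ ≤ R)
    (hE : IntegrableOn (gradInner V V) Ω) :
    IntegrableOn (gradInner W W) Ω ∧
      ∫ z in Ω, gradInner W W z ≤ ∫ z in Ω, gradInner V V z := by
  set D : ℂ → ℝ := fun z ↦ W z - V z
  have hW1 : ContDiffOn ℝ 1 W Ω := fun z hz ↦ ((hW z hz).1.of_le (by norm_num)).contDiffWithinAt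
  have hD : ContDiffOn ℝ 1 D Ω := hW1.sub hV
  have hdiff : ∀ {f : ℂ → ℝ} (_ : ContDiffOn ℝ 1 f Ω), ∀ z ∈ Ω, DifferentiableAt ℝ f z :=
    fun hf z hz ↦ ((hf z hz).contDiffAt (hΩ.mem_nhds hz)).differentiableAt one_ne_zero
  -- Truncations of `D` see only the set where `D ≠ 0`; on the rest of `Ω` the gradients of `W` and
  -- `V` agree almost everywhere.
  set A := Ω ∩ {z | D z ≠ 0}
  have hAo : IsOpen A := hD.continuousOn.isOpen_inter_preimage hΩ isOpen_ne
  have hAΩ : A ⊆ Ω := inter_subset_left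
  set C := ∫ z in A, gradInner V V z
  have hC : 0 ≤ C := integral_nonneg fun z ↦ gradInner_self_nonneg V z
  have hEA : IntegrableOn (gradInner V V) A := hE.mono_set hAΩ
  have hcW : ContinuousOn (gradInner W W) Ω := continuousOn_gradInner hΩ hW1 hW1
  have hstep : ∀ n : ℕ, ∫⁻ z in A, ENNReal.ofReal (cutSlope n (D z) * gradInner W W z) ≤
      ENNReal.ofReal C := by
    intro n
    rcases n.eq_zero_or_pos with rfl | hn
    · simp [cutSlope]
    have hδ : (0 : ℝ) < 1 / n := by positivity
    set K := {z | z ∈ closure Ω ∧ 1 / (n : ℝ) ≤ |D z|}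
    have hKcl : IsClosed K := isClosed_superlevel hc
    have hKΩ : K ⊆ Ω := superlevel_subset hδ h0
    have hKc : IsCompact K := by
      obtain ⟨R, hR⟩ := hinf _ hδ
      exact (isCompact_closedBall (0 : ℂ) R).of_isClosed_subset hKcl fun z hz ↦
        mem_closedBall_zero_iff.2 (hR z hz.1 hz.2)
    set η := zeroExtend Ω (cut n ∘ D)
    have hηK : tsupport η ⊆ K := tsupport_zeroExtend_subset hc fun x hx ↦ cut_eq_zero x hx
    have hη : ContDiff ℝ 1 η := contDiff_zeroExtend hΩ hD hc h0 hδ (contDiff_cut n)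
      fun x hx ↦ cut_eq_zero x hx
    have hηc : HasCompactSupport η := hKc.of_isClosed_subset (isClosed_tsupport _) hηK
    obtain ⟨-, hint⟩ := integrable_gradInner_and_integral_eq_zero hΩ hW hη hηc (hηK.trans hKΩ)
    have hout : ∀ z ∉ K, z ∈ Ω → cutSlope n (D z) = 0 := by
      intro z hz hzΩ
      have h1 : |D z| < 1 / n := by
        by_contra! h; exact hz ⟨subset_closure hzΩ, h⟩
      have hn' : (0 : ℝ) < n := by exact_mod_cast hn
      rw [lt_div_iff₀ hn'] at h1
      have : (n : ℝ) * |D z| - 1 ≤ 0 := by linarith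
      simp [cutSlope, max_eq_left this]
    have hcont : ∀ {g : ℂ → ℝ} (_ : ContinuousOn g Ω),
        IntegrableOn (fun z ↦ cutSlope n (D z) * g z) Ω := by
      intro g hg
      have h1 : ContinuousOn (fun z ↦ cutSlope n (D z) * g z) Ω :=
        ((continuous_cutSlope n).comp_continuousOn hD.continuousOn).mul hg
      have h2 : IntegrableOn (fun z ↦ cutSlope n (D z) * g z) K :=
        (h1.mono hKΩ).integrableOn_compact hKc
      refine h2.of_forall_sdiff_eq_zero hΩ.measurableSet fun z hz ↦ ?_
      rw [hout z hz.2 hz.1, zero_mul]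
    -- This is weak harmonicity of `W` tested against `cut n ∘ D`. The slope confines every integral
    -- to the compact set `K`, so all are finite although the energy of `W` is not yet known to be.
    have hz0 : ∫ z in Ω, cutSlope n (D z) * gradInner D W z = 0 := by
      have h1 : ∫ z in Ω, gradInner η W z = ∫ z, gradInner η W z :=
        setIntegral_eq_integral_of_forall_compl_eq_zero fun z hz ↦ by
          have := fderiv_zeroExtend_of_notMem hc h0 hδ
            (fun x hx ↦ cut_eq_zero (n := n) x hx) hz
          simp only [gradInner, η]
          erw [this]
          simp
      rw [← hint, ← h1]
      refine setIntegral_congr_fun hΩ.measurableSet fun z hz ↦ ?_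
      simp only [η]
      rw [gradInner_zeroExtend hΩ hD (contDiff_cut n) W hz, deriv_cut]
    have iW := hcont hcW
    have iV := hcont (continuousOn_gradInner hΩ hV hV)
    have hle : ∫ z in Ω, cutSlope n (D z) * gradInner W W z ≤
        ∫ z in Ω, cutSlope n (D z) * gradInner V V z := by
      -- The integrand is `cutSlope n (D z)` times `|∇V - ∇W|²`, and the term carrying the factor
      -- `2` integrates to zero.
      have h1 : 0 ≤ ∫ z in Ω, ((cutSlope n (D z) * gradInner V V z -
          cutSlope n (D z) * gradInner W W z) + 2 * (cutSlope n (D z) * gradInner D W z)) := by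
        refine setIntegral_nonneg hΩ.measurableSet fun z hz ↦ ?_
        have e : gradInner D W z = gradInner W W z - gradInner V W z :=
          gradInner_sub_left (hdiff hW1 z hz) (hdiff hV z hz)
        have := two_mul_gradInner_le V W z
        rw [e]
        have := mul_nonneg (cutSlope_nonneg n (D z))
          (show 0 ≤ gradInner V V z + gradInner W W z - 2 * gradInner V W z by linarith)
        linarith
      have iD := hcont (continuousOn_gradInner hΩ hD hW1)
      have iVW : IntegrableOn (fun z ↦ cutSlope n (D z) * gradInner V V z -
          cutSlope n (D z) * gradInner W W z) Ω := iV.sub iW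
      rw [integral_add iVW (iD.const_mul 2), integral_sub iV iW, integral_const_mul, hz0] at h1
      linarith
    have hle2 : ∫ z in Ω, cutSlope n (D z) * gradInner V V z ≤ C := by
      rw [setIntegral_eq_of_subset_of_forall_sdiff_eq_zero hΩ.measurableSet hAΩ]
      · refine setIntegral_mono_on (iV.mono_set hAΩ) hEA hAo.measurableSet fun z _ ↦ ?_
        exact mul_le_of_le_one_left (gradInner_self_nonneg V z) (cutSlope_le_one n _)
      · intro z hz
        have : D z = 0 := by
          by_contra h; exact hz.2 ⟨hz.1, h⟩
        rw [this, cutSlope_zero, zero_mul]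
    have hnn : ∀ z, 0 ≤ cutSlope n (D z) * gradInner W W z := fun z ↦
      mul_nonneg (cutSlope_nonneg n _) (gradInner_self_nonneg W z)
    calc _ ≤ ∫⁻ z in Ω, ENNReal.ofReal (cutSlope n (D z) * gradInner W W z) :=
          lintegral_mono_set hAΩ
      _ = ENNReal.ofReal (∫ z in Ω, cutSlope n (D z) * gradInner W W z) :=
          (ofReal_integral_eq_lintegral_ofReal iW (Eventually.of_forall hnn)).symm
      _ ≤ ENNReal.ofReal C := ENNReal.ofReal_le_ofReal (hle.trans hle2)
  have hA : IntegrableOn (gradInner W W) A ∧ ∫ z in A, gradInner W W z ≤ C := by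
    refine integrableOn_and_setIntegral_le_of_lintegral_le hAo.measurableSet (hcW.mono hAΩ)
      (fun z ↦ gradInner_self_nonneg W z) hC ?_
    have hmeas : ∀ n, AEMeasurable (fun z ↦ ENNReal.ofReal (cutSlope n (D z) * gradInner W W z))
        (volume.restrict A) := fun n ↦ by
      refine ENNReal.measurable_ofReal.comp_aemeasurable ?_
      exact ((((continuous_cutSlope n).comp_continuousOn hD.continuousOn).mul
        hcW).mono hAΩ).aemeasurable hAo.measurableSet
    -- The slopes tend to `1` on `A`; Fatou's lemma yields finiteness of the energy and the bound
    -- together.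
    have hlim : ∀ᵐ z ∂volume.restrict A, ENNReal.ofReal (gradInner W W z) =
        liminf (fun n ↦ ENNReal.ofReal (cutSlope n (D z) * gradInner W W z)) atTop := by
      filter_upwards [ae_restrict_mem hAo.measurableSet] with z hz
      refine (Tendsto.liminf_eq ?_).symm
      have := (tendsto_cutSlope hz.2).mul_const (gradInner W W z)
      rw [one_mul] at this
      exact (ENNReal.continuous_ofReal.tendsto _).comp this
    rw [lintegral_congr_ae hlim]
    refine (lintegral_liminf_le' hmeas).trans ?_
    exact liminf_le_of_le (by isBoundedDefault) fun b hb ↦ by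
      obtain ⟨n, hn⟩ := hb.exists
      exact hn.trans (hstep n)
  set B := Ω \ A
  have hBm : MeasurableSet B := hΩ.measurableSet.diff hAo.measurableSet
  have hB : ∀ᵐ z ∂volume.restrict B, gradInner W W z = gradInner V V z := by
    have hBΩ : ∀ z ∈ B, z ∈ Ω := fun z hz ↦ hz.1
    have h := ae_fderiv_eq_zero_of_eq_zero hBm (fun z hz ↦ hdiff hD z (hBΩ z hz)) fun z hz ↦ by
      by_contra h; exact hz.2 ⟨hz.1, h⟩
    filter_upwards [h, ae_restrict_mem hBm] with z hz hzB
    have : fderiv ℝ W z = fderiv ℝ V z := by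
      have h2 := fderiv_fun_sub (hdiff hW1 z (hBΩ z hzB)) (hdiff hV z (hBΩ z hzB))
      rw [← sub_eq_zero, ← h2]; exact hz
    simp only [gradInner, this]
  have hEB : IntegrableOn (gradInner V V) B := hE.mono_set sdiff_subset
  have hWB : IntegrableOn (gradInner W W) B := hEB.congr (hB.mono fun z hz ↦ hz.symm)
  have hun : Ω = A ∪ B := (union_sdiff_cancel hAΩ).symm
  have hdis : Disjoint A B := disjoint_sdiff_right
  rw [hun]
  refine ⟨hA.1.union hWB, ?_⟩
  rw [setIntegral_union hdis hBm hA.1 hWB, setIntegral_union hdis hBm hEA hEB,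
    integral_congr_ae hB]
  linarith [hA.2]

/-! ### Uniqueness: parabolicity of the plane -/

lemma cut_ne_zero {n : ℕ} {x : ℝ} (hn : 0 < n) (hx : 1 / n < |x|) : cut n x ≠ 0 := by
  have hn' : (0 : ℝ) < n := by exact_mod_cast hn
  have hpos : ∀ y : ℝ, 1 / n < |y| → 0 < deriv (cut n) y := fun y hy ↦ by
    rw [deriv_cut, cutSlope]
    rw [div_lt_iff₀ hn'] at hy
    exact lt_min one_pos (lt_max_of_lt_right (by linarith))
  have hc : Continuous (cut n) := (contDiff_cut n).continuous
  have h0 : (0 : ℝ) < 1 / n := by positivity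
  rcases lt_abs.1 hx with h | h
  · have hm : StrictMonoOn (cut n) (Ici (1 / (n : ℝ))) :=
      strictMonoOn_of_deriv_pos (convex_Ici _) hc.continuousOn fun y hy ↦ by
        rw [interior_Ici] at hy
        exact hpos y (lt_of_lt_of_le hy (le_abs_self y))
    have := hm self_mem_Ici h.le h
    rw [cut_eq_zero _ (abs_of_pos h0).le] at this
    exact this.ne'
  · have hm : StrictMonoOn (cut n) (Iic (-(1 / (n : ℝ)))) :=
      strictMonoOn_of_deriv_pos (convex_Iic _) hc.continuousOn fun y hy ↦ by
        rw [interior_Iic] at hy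
        exact hpos y (lt_of_lt_of_le (lt_neg_of_lt_neg hy) (neg_le_abs y))
    have := hm (show x ∈ Iic (-(1 / (n : ℝ))) by simp only [mem_Iic]; linarith) self_mem_Iic
      (show x < -(1 / (n : ℝ)) by linarith)
    rw [cut_eq_zero (-(1 / (n : ℝ))) (by rw [abs_neg, abs_of_pos h0])] at this
    exact this.ne

lemma gradInner_mul_left {f g h : ℂ → ℝ} {z : ℂ} (hf : DifferentiableAt ℝ f z)
    (hg : DifferentiableAt ℝ g z) :
    gradInner (fun z ↦ f z * g z) h z = f z * gradInner g h z + g z * gradInner f h z := by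
  simp only [gradInner, fderiv_fun_mul hf hg, add_apply, smul_apply, smul_eq_mul]
  ring

lemma gradInner_comp_inv_smul {χ : ℂ → ℝ} (hχ : Differentiable ℝ χ) (R : ℝ) (z : ℂ) :
    gradInner (fun z ↦ χ (R⁻¹ • z)) (fun z ↦ χ (R⁻¹ • z)) z =
      (R⁻¹) ^ 2 * gradInner χ χ (R⁻¹ • z) := by
  have h : ∀ v, fderiv ℝ (fun z ↦ χ (R⁻¹ • z)) z v = R⁻¹ * fderiv ℝ χ (R⁻¹ • z) v := fun v ↦ by
    have h1 : HasFDerivAt (fun z : ℂ ↦ R⁻¹ • z) (R⁻¹ • ContinuousLinearMap.id ℝ ℂ) z :=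
      (hasFDerivAt_id z).const_smul R⁻¹
    have h2 := ((hχ (R⁻¹ • z)).hasFDerivAt.comp z h1).fderiv
    have h3 : fderiv ℝ (fun z ↦ χ (R⁻¹ • z)) z = _ := h2
    rw [h3]
    simp
  simp only [gradInner, h]
  ring

lemma continuous_gradInner {f g : ℂ → ℝ} (hf : ContDiff ℝ 1 f) (hg : ContDiff ℝ 1 g) :
    Continuous (gradInner f g) := by
  rw [← continuousOn_univ]
  exact continuousOn_gradInner isOpen_univ hf.contDiffOn hg.contDiffOn

/-- In dimension two the factor `R⁻²` from the squared gradient cancels the Jacobian `R²`. This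
conformal invariance keeps the cutoff energy bounded at all scales. -/
lemma integral_gradInner_comp_inv_smul {χ : ℂ → ℝ} (hχ : Differentiable ℝ χ) {R : ℝ} (hR : 0 < R) :
    ∫ z, gradInner (fun z ↦ χ (R⁻¹ • z)) (fun z ↦ χ (R⁻¹ • z)) z = ∫ z, gradInner χ χ z := by
  simp only [gradInner_comp_inv_smul hχ]
  rw [integral_const_mul, Measure.integral_comp_inv_smul volume (fun z ↦ gradInner χ χ z) R,
    Complex.finrank_real_complex, abs_of_pos (by positivity), smul_eq_mul, ← mul_assoc,
    ← mul_pow, inv_mul_cancel₀ hR.ne', one_pow, one_mul]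

/-- In the plane a harmonic function of finite Dirichlet energy that vanishes continuously on the
boundary is zero, even on an unbounded domain. -/
theorem eq_zero_of_integrableOn_gradInner {Ω : Set ℂ} {w : ℂ → ℝ} (hΩ : IsOpen Ω)
    (hne : Ω ≠ univ) (hw : HarmonicOnNhd w Ω) (hc : ContinuousOn w (closure Ω))
    (h0 : ∀ z ∈ closure Ω, z ∉ Ω → w z = 0) (hE : IntegrableOn (gradInner w w) Ω) :
    ∀ z ∈ Ω, w z = 0 := by
  have hw1 : ContDiffOn ℝ 1 w Ω := fun z hz ↦ ((hw z hz).1.of_le (by norm_num)).contDiffWithinAt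
  suffices hmain : ∀ n : ℕ, 0 < n → ∀ z ∈ Ω, cut n (w z) = 0 by
    intro z hz
    by_contra h
    obtain ⟨n, hn⟩ := exists_nat_one_div_lt (abs_pos.2 h)
    exact cut_ne_zero n.succ_pos (by push_cast; exact hn) (hmain (n + 1) n.succ_pos z hz)
  intro n hn
  have hδ : (0 : ℝ) < 1 / n := by positivity
  -- The cut keeps the support away from the boundary. The arctangent makes the test function
  -- bounded, as `w` itself may be unbounded, and keeps the slope in `[0, 1]`.
  set ψ : ℝ → ℝ := fun x ↦ arctan (cut n x) with hψdef
  have hψ1 : ContDiff ℝ 1 ψ := contDiff_arctan.comp (contDiff_cut n)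
  have hψ0 : ∀ x : ℝ, |x| ≤ 1 / n → ψ x = 0 := fun x hx ↦ by simp [hψdef, cut_eq_zero x hx]
  have hψd : ∀ x, 0 ≤ deriv ψ x ∧ deriv ψ x ≤ 1 := fun x ↦ by
    have h := ((hasDerivAt_cut n x).arctan).deriv
    have h' : deriv ψ x = 1 / (1 + cut n x ^ 2) * cutSlope n x := h
    rw [h']
    have h1 : 0 ≤ 1 / (1 + cut n x ^ 2) := by positivity
    have h2 : 1 / (1 + cut n x ^ 2) ≤ 1 := by
      rw [div_le_one (by positivity)]; nlinarith [sq_nonneg (cut n x)]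
    exact ⟨mul_nonneg h1 (cutSlope_nonneg n x),
      mul_le_one₀ h2 (cutSlope_nonneg n x) (cutSlope_le_one n x)⟩
  set Ψ := zeroExtend Ω (ψ ∘ w)
  have hΨ : ContDiff ℝ 1 Ψ := contDiff_zeroExtend hΩ hw1 hc h0 hδ hψ1 hψ0
  have hΨs : tsupport Ψ ⊆ Ω :=
    (tsupport_zeroExtend_subset hc hψ0).trans (superlevel_subset hδ h0)
  have hΨout : ∀ z ∉ Ω, fderiv ℝ Ψ z = 0 := fun z hz ↦
    fderiv_zeroExtend_of_notMem hc h0 hδ hψ0 hz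
  have hΨb : ∀ z, |Ψ z| ≤ 2 := fun z ↦ by
    by_cases hz : z ∈ Ω
    · have e : Ψ z = arctan (cut n (w z)) := zeroExtend_of_mem hz
      rw [e, abs_le]
      constructor <;>
        linarith [neg_pi_div_two_lt_arctan (cut n (w z)), arctan_lt_pi_div_two (cut n (w z)),
          Real.pi_lt_four]
    · have e : Ψ z = 0 := zeroExtend_of_notMem hz
      simp [e]
  set G : ℂ → ℝ := Ω.indicator (gradInner w w)
  have hG : Integrable G := hE.integrable_indicator hΩ.measurableSet
  have hGin : ∀ z ∈ Ω, G z = gradInner w w z := fun z hz ↦ indicator_of_mem hz _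
  have hG0 : ∀ z, 0 ≤ G z := indicator_nonneg fun z _ ↦ gradInner_self_nonneg w z
  set T : ℂ → ℝ := gradInner Ψ w with hTdef
  have hTin : ∀ z ∈ Ω, T z = deriv ψ (w z) * gradInner w w z := fun z hz ↦
    gradInner_zeroExtend hΩ hw1 hψ1 w hz
  have hTout : ∀ z ∉ Ω, T z = 0 := fun z hz ↦ by simp [hTdef, gradInner, hΨout z hz]
  have hT0 : ∀ z, 0 ≤ T z := fun z ↦ by
    by_cases hz : z ∈ Ω
    · rw [hTin z hz]; exact mul_nonneg (hψd _).1 (gradInner_self_nonneg w z)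
    · rw [hTout z hz]
  have hTG : ∀ z, T z ≤ G z := fun z ↦ by
    by_cases hz : z ∈ Ω
    · rw [hTin z hz, hGin z hz]
      exact mul_le_of_le_one_left (gradInner_self_nonneg w z) (hψd _).2
    · rw [hTout z hz]; exact hG0 z
  have hΨT : ∀ z, gradInner Ψ Ψ z ≤ T z := fun z ↦ by
    by_cases hz : z ∈ Ω
    · have h1 : gradInner Ψ Ψ z = deriv ψ (w z) * gradInner w Ψ z :=
        gradInner_zeroExtend hΩ hw1 hψ1 Ψ hz
      rw [gradInner_comm w Ψ] at h1
      rw [h1]; exact mul_le_of_le_one_left (hT0 z) (hψd _).2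
    · simp [hTout z hz, gradInner, hΨout z hz]
  have hTc : Continuous T := by
    have h1 : ∀ v, Continuous fun z ↦ fderiv ℝ w z v * fderiv ℝ Ψ z v := fun v ↦
      continuous_mul_of_tsupport_subset hΩ
        ((hw1.continuousOn_fderiv_of_isOpen hΩ le_rfl).clm_apply continuousOn_const)
        ((hΨ.continuous_fderiv one_ne_zero).clm_apply continuous_const)
        ((tsupport_fderiv_apply_subset ℝ v).trans hΨs)
    refine ((h1 1).add (h1 Complex.I)).congr fun z ↦ ?_
    simp only [hTdef, gradInner, Pi.add_apply]; ring
  have hTi : Integrable T := hG.mono' hTc.aestronglyMeasurable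
    (Eventually.of_forall fun z ↦ by rw [Real.norm_of_nonneg (hT0 z)]; exact hTG z)
  let bump : ContDiffBump (0 : ℂ) := ⟨1, 2, one_pos, one_lt_two⟩
  set χ : ℂ → ℝ := ⇑bump
  have hχ1 : ContDiff ℝ 1 χ := bump.contDiff
  have hχd : Differentiable ℝ χ := hχ1.differentiable one_ne_zero
  set C := ∫ z, gradInner χ χ z
  set X : ℕ → ℂ → ℝ := fun k z ↦ χ (((k : ℝ) + 1)⁻¹ • z)
  have hk : ∀ k : ℕ, (0 : ℝ) < (k : ℝ) + 1 := fun k ↦ by positivity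
  have hX1 : ∀ k, ContDiff ℝ 1 (X k) := fun k ↦ hχ1.comp (contDiff_const_smul _)
  have hXc : ∀ k, HasCompactSupport (X k) := fun k ↦
    bump.hasCompactSupport.comp_smul (inv_ne_zero (hk k).ne')
  have hXone : ∀ k : ℕ, ∀ z : ℂ, ‖z‖ ≤ (k : ℝ) + 1 → X k z = 1 := fun k z hz ↦ by
    refine bump.one_of_mem_closedBall ?_
    rw [mem_closedBall_zero_iff, norm_smul, norm_inv, Real.norm_of_nonneg (hk k).le]
    exact (inv_mul_le_one₀ (hk k)).2 hz
  have hXC : ∀ k, ∫ z, gradInner (X k) (X k) z = C := fun k ↦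
    integral_gradInner_comp_inv_smul hχd (hk k)
  have hXi : ∀ k, Integrable (gradInner (X k) (X k)) := fun k ↦ by
    refine (continuous_gradInner (hX1 k) (hX1 k)).integrable_of_hasCompactSupport ?_
    refine HasCompactSupport.intro (hXc k) fun z hz ↦ ?_
    have : fderiv ℝ (X k) z = 0 := by
      rw [(notMem_tsupport_iff_eventuallyEq.1 hz).fderiv_eq]; simp
    simp [gradInner, this]
  set b : ℕ → ℝ := fun k ↦ ∫ z, {z : ℂ | (k : ℝ) + 1 ≤ ‖z‖}.indicator G z
  have hmeas : ∀ k : ℕ, MeasurableSet {z : ℂ | (k : ℝ) + 1 ≤ ‖z‖} := fun k ↦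
    measurableSet_le measurable_const measurable_norm
  have hb : Tendsto b atTop (𝓝 0) := by
    have : Tendsto b atTop (𝓝 (∫ _ : ℂ, (0 : ℝ))) := by
      refine tendsto_integral_of_dominated_convergence G (fun k ↦
        (hG.indicator (hmeas k)).aestronglyMeasurable) hG
        (fun k ↦ Eventually.of_forall fun z ↦ ?_) (Eventually.of_forall fun z ↦ ?_)
      · rw [Real.norm_of_nonneg (indicator_nonneg (fun z _ ↦ hG0 z) z)]
        exact indicator_le_self' (fun z _ ↦ hG0 z) z
      · refine tendsto_const_nhds.congr' ?_
        filter_upwards [tendsto_natCast_atTop_atTop.eventually_gt_atTop ‖z‖] with k hk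
        refine (indicator_of_notMem ?_ _).symm
        simp only [mem_ofPred_eq, not_le]
        linarith
    simpa using this
  have hlim : Tendsto (fun k ↦ ∫ z, X k z * T z) atTop (𝓝 (∫ z, T z)) := by
    refine tendsto_integral_of_dominated_convergence T (fun k ↦
      ((hX1 k).continuous.mul hTc).aestronglyMeasurable) hTi
      (fun k ↦ Eventually.of_forall fun z ↦ ?_) (Eventually.of_forall fun z ↦ ?_)
    · rw [norm_mul, Real.norm_of_nonneg (hT0 z), Real.norm_of_nonneg bump.nonneg]
      exact mul_le_of_le_one_left (hT0 z) bump.le_one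
    · refine tendsto_const_nhds.congr' ?_
      filter_upwards [tendsto_natCast_atTop_atTop.eventually_gt_atTop ‖z‖] with k hk
      rw [hXone k z (by linarith), one_mul]
  -- Testing with `X k * Ψ` turns `∫ X k * T` into minus the integral of `Ψ ∇X_k · ∇w`, which lives
  -- where `|z| ≥ k + 1`. Young's inequality bounds it by `δ` times the fixed cutoff energy plus
  -- `δ⁻¹` times the tail of the energy of `w`. Then `k → ∞` first, and `δ → 0` afterwards.
  have hbound : ∀ δ > 0, ∀ k, ∫ z, X k z * T z ≤ δ * C + δ⁻¹ * b k := by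
    intro δ hδ k
    have hη1 : ContDiff ℝ 1 fun z ↦ X k z * Ψ z := (hX1 k).mul hΨ
    obtain ⟨hi, hz⟩ := integrable_gradInner_and_integral_eq_zero hΩ hw hη1 (hXc k).mul_right
      ((closure_mono (Function.support_mul_subset_right _ _)).trans hΨs)
    have hXT : Integrable fun z ↦ X k z * T z :=
      ((hX1 k).continuous.mul hTc).integrable_of_hasCompactSupport (hXc k).mul_right
    have hpt : ∀ z, X k z * T z - gradInner (fun z ↦ X k z * Ψ z) w z ≤
        δ * gradInner (X k) (X k) z + δ⁻¹ * {z : ℂ | (k : ℝ) + 1 ≤ ‖z‖}.indicator G z := by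
      intro z
      rw [gradInner_mul_left ((hX1 k).differentiable one_ne_zero z)
        (hΨ.differentiable one_ne_zero z)]
      have hr1 := mul_nonneg hδ.le (gradInner_self_nonneg (X k) z)
      have hr2 : 0 ≤ δ⁻¹ * {z : ℂ | (k : ℝ) + 1 ≤ ‖z‖}.indicator G z :=
        mul_nonneg (inv_pos.2 hδ).le (indicator_nonneg (fun z _ ↦ hG0 z) z)
      suffices h : |Ψ z * gradInner (X k) w z| ≤ δ * gradInner (X k) (X k) z +
          δ⁻¹ * {z : ℂ | (k : ℝ) + 1 ≤ ‖z‖}.indicator G z by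
        have := neg_abs_le (Ψ z * gradInner (X k) w z)
        linarith
      by_cases hzΩ : z ∈ Ω
      swap
      · have e : Ψ z = 0 := zeroExtend_of_notMem hzΩ
        rw [e, zero_mul, abs_zero]; linarith
      by_cases hzk : (k : ℝ) + 1 ≤ ‖z‖
      · rw [indicator_of_mem (show z ∈ {z : ℂ | (k : ℝ) + 1 ≤ ‖z‖} from hzk), hGin z hzΩ, abs_mul]
        have h1 := abs_gradInner_le (X k) w z hδ
        have h2 := mul_le_mul (hΨb z) h1 (abs_nonneg _) zero_le_two
        linarith
      · have : fderiv ℝ (X k) z = 0 := by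
          have : X k =ᶠ[𝓝 z] fun _ ↦ 1 := by
            filter_upwards [(isOpen_lt continuous_norm continuous_const).mem_nhds
              (not_le.1 hzk)] with y hy using hXone k y (le_of_lt hy)
          rw [this.fderiv_eq]; simp
        have e : gradInner (X k) w z = 0 := by simp [gradInner, this]
        rw [e, mul_zero, abs_zero]; linarith
    have h1 := integral_mono (hXT.sub hi) (((hXi k).const_mul δ).add
      ((hG.indicator (hmeas k)).const_mul δ⁻¹)) hpt
    simp only [Pi.sub_apply, Pi.add_apply] at h1
    rw [integral_sub hXT hi, hz, sub_zero, integral_add ((hXi k).const_mul δ)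
      ((hG.indicator (hmeas k)).const_mul δ⁻¹), integral_const_mul, integral_const_mul, hXC] at h1
    exact h1
  have hTle : ∀ δ > 0, ∫ z, T z ≤ δ * C := fun δ hδ ↦ by
    have h1 : Tendsto (fun k ↦ δ * C + δ⁻¹ * b k) atTop (𝓝 (δ * C + δ⁻¹ * 0)) :=
      (hb.const_mul _).const_add _
    rw [mul_zero, add_zero] at h1
    exact le_of_tendsto_of_tendsto' hlim h1 (hbound δ hδ)
  have hT00 : ∫ z, T z ≤ 0 := by
    have h1 : Tendsto (fun δ : ℝ ↦ δ * C) (𝓝[>] 0) (𝓝 (0 * C)) :=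
      (tendsto_id.mono_left nhdsWithin_le_nhds).mul_const C
    rw [zero_mul] at h1
    exact ge_of_tendsto h1 (by filter_upwards [self_mem_nhdsWithin] with δ hδ using hTle δ hδ)
  have hΨc : Continuous (gradInner Ψ Ψ) := continuous_gradInner hΨ hΨ
  have hΨi : Integrable (gradInner Ψ Ψ) := hTi.mono' hΨc.aestronglyMeasurable
    (Eventually.of_forall fun z ↦ by
      rw [Real.norm_of_nonneg (gradInner_self_nonneg Ψ z)]; exact hΨT z)
  have hΨ0 : ∫ z, gradInner Ψ Ψ z = 0 :=
    le_antisymm ((integral_mono hΨi hTi hΨT).trans hT00)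
      (integral_nonneg fun z ↦ gradInner_self_nonneg Ψ z)
  rw [integral_eq_zero_iff_of_nonneg (fun z ↦ gradInner_self_nonneg Ψ z) hΨi] at hΨ0
  have hΨ00 := (hΨc.ae_eq_iff_eq volume continuous_zero).1 hΨ0
  have hfd : ∀ z, fderiv ℝ Ψ z = 0 := fun z ↦ by
    have h := congrFun hΨ00 z
    simp only [gradInner, Pi.zero_apply] at h
    have h1 : fderiv ℝ Ψ z 1 = 0 := by
      nlinarith [mul_self_nonneg (fderiv ℝ Ψ z 1), mul_self_nonneg (fderiv ℝ Ψ z Complex.I)]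
    have h2 : fderiv ℝ Ψ z Complex.I = 0 := by
      nlinarith [mul_self_nonneg (fderiv ℝ Ψ z 1), mul_self_nonneg (fderiv ℝ Ψ z Complex.I)]
    ext v
    have : v = v.re • (1 : ℂ) + v.im • Complex.I := by
      apply Complex.ext <;> simp
    rw [this, map_add, map_smul, map_smul, h1, h2]
    simp
  -- `Ψ` has zero gradient on the whole plane, so one point outside `Ω` fixes the constant as `0`.
  obtain ⟨z₀, hz₀⟩ := (ne_univ_iff_exists_notMem Ω).1 hne
  intro z hz
  have h1 := is_const_of_fderiv_eq_zero (hΨ.differentiable one_ne_zero) hfd z z₀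
  have e0 : Ψ z₀ = 0 := zeroExtend_of_notMem hz₀
  have e1 : Ψ z = arctan (cut n (w z)) := zeroExtend_of_mem hz
  rw [e0, e1, arctan_eq_zero_iff] at h1
  exact h1

/-! ### Angular integrals -/

/-- The square of `s t` at the point of the quadrant with polar coordinates `(r, θ)` about
`(1, 1)`, and zero off the quadrant. -/
noncomputable def angularDensity (r θ : ℝ) : ℝ :=
  (max 0 (1 + r * cos θ) * max 0 (1 + r * sin θ)) ^ 2

lemma continuous_angularDensity (r : ℝ) : Continuous (angularDensity r) := by
  unfold angularDensity; fun_prop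

lemma hasDerivAt_max_zero_pow_three (x : ℝ) :
    HasDerivAt (fun x : ℝ ↦ max 0 x ^ 3) (3 * max 0 x ^ 2) x := by
  rcases lt_trichotomy x 0 with h | rfl | h
  · have e : (fun x : ℝ ↦ max 0 x ^ 3) =ᶠ[𝓝 x] fun _ ↦ 0 := by
      filter_upwards [gt_mem_nhds h] with y hy
      simp [max_eq_left (le_of_lt hy)]
    rw [max_eq_left h.le]
    simpa using (hasDerivAt_const x (0 : ℝ)).congr_of_eventuallyEq e
  · have hO : (fun x : ℝ ↦ max 0 x ^ 3) =O[𝓝 0] fun x ↦ ‖x - 0‖ ^ 3 := by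
      refine Asymptotics.IsBigO.of_bound 1 (Eventually.of_forall fun y ↦ ?_)
      rw [sub_zero, one_mul, norm_pow, norm_pow, norm_norm]
      gcongr
      rw [Real.norm_of_nonneg (le_max_left 0 y)]
      exact max_le (norm_nonneg y) (le_abs_self y)
    have := (hO.hasFDerivAt (by norm_num)).hasDerivAt
    simpa using this
  · have e : (fun x : ℝ ↦ max 0 x ^ 3) =ᶠ[𝓝 x] fun y ↦ y ^ 3 := by
      filter_upwards [lt_mem_nhds h] with y hy
      rw [max_eq_right (le_of_lt hy)]
    rw [max_eq_right h.le]
    simpa using (hasDerivAt_pow 3 x).congr_of_eventuallyEq e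

lemma integral_angularDensity_first (r : ℝ) (hr : 1 ≤ r) :
    ∫ θ in (0 : ℝ)..π / 2, angularDensity r θ =
      π / 2 + 4 * r + (π / 2 + 2) * r ^ 2 + 4 / 3 * r ^ 3 + π / 16 * r ^ 4 := by
  have h1 : ∀ θ ∈ uIcc 0 (π / 2), angularDensity r θ =
      ((1 + r * cos θ) * (1 + r * sin θ)) ^ 2 := fun θ hθ ↦ by
    rw [uIcc_of_le (by positivity)] at hθ
    have hs := sin_nonneg_of_nonneg_of_le_pi hθ.1 (by linarith [hθ.2, Real.pi_pos])
    have hc := cos_nonneg_of_neg_pi_div_two_le_of_le (by linarith [hθ.1, Real.pi_pos]) hθ.2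
    rw [angularDensity, max_eq_right (by nlinarith), max_eq_right (by nlinarith)]
  rw [intervalIntegral.integral_congr h1]
  have hd : ∀ θ ∈ uIcc 0 (π / 2), HasDerivAt (fun θ ↦ θ + 2 * r * (sin θ - cos θ) + r ^ 2 * θ +
      2 * r ^ 2 * sin θ ^ 2 + 2 / 3 * r ^ 3 * (sin θ ^ 3 - cos θ ^ 3) +
      r ^ 4 / 8 * (θ - sin θ * cos θ * (cos θ ^ 2 - sin θ ^ 2)))
      (((1 + r * cos θ) * (1 + r * sin θ)) ^ 2) θ := fun θ _ ↦ by
    have s := hasDerivAt_sin θ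
    have c := hasDerivAt_cos θ
    have i := hasDerivAt_id' θ
    have := (((((i.add ((s.sub c).const_mul (2 * r))).add (i.const_mul (r ^ 2))).add
      ((s.pow 2).const_mul (2 * r ^ 2))).add
      (((s.pow 3).sub (c.pow 3)).const_mul (2 / 3 * r ^ 3))).add
      ((i.sub ((s.mul c).mul ((c.pow 2).sub (s.pow 2)))).const_mul (r ^ 4 / 8)))
    refine this.congr_deriv ?_
    simp only [Pi.mul_apply, Pi.sub_apply, Pi.pow_apply]
    have e : sin θ ^ 2 = 1 - cos θ ^ 2 := by linarith [sin_sq_add_cos_sq θ]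
    have e4 : sin θ ^ 4 = (1 - cos θ ^ 2) ^ 2 := by rw [← e]; ring
    ring_nf
    simp only [e, e4]
    ring
  rw [intervalIntegral.integral_eq_sub_of_hasDerivAt hd
    (Continuous.intervalIntegrable (by fun_prop) _ _)]
  simp
  ring

/-- With `m` the truncated sine factor, `r cos θ ≤ r` gives `(1 + r cos θ)² ≤ 1 + (r + 2) r cos θ`.
The `1` is paired with `m² ≤ (1 + sin θ)²`, valid as `r ≥ 1`. The rest is exactly integrable: `m² r
cos θ` is the derivative of `m³ / 3`. -/
lemma integral_angularDensity_fourth (r : ℝ) (hr : 1 ≤ r) :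
    ∫ θ in (-(π / 2))..0, angularDensity r θ ≤ (r + 2) / 3 + (3 * π / 4 - 2) := by
  have hle : ∀ θ ∈ Icc (-(π / 2)) 0, angularDensity r θ ≤
      (1 + sin θ) ^ 2 + (r + 2) * (max 0 (1 + r * sin θ) ^ 2 * (r * cos θ)) := fun θ hθ ↦ by
    have hs : sin θ ≤ 0 := sin_nonpos_of_nonpos_of_neg_pi_le hθ.2 (by linarith [hθ.1, Real.pi_pos])
    have hc := cos_nonneg_of_neg_pi_div_two_le_of_le hθ.1 (by linarith [hθ.2, Real.pi_pos])
    have hc1 := cos_le_one θ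
    have hs1 := neg_one_le_sin θ
    set m := max 0 (1 + r * sin θ) with hm
    have hm0 : 0 ≤ m := le_max_left _ _
    have hm1 : m ≤ 1 + sin θ := max_le (by linarith) (by nlinarith)
    have hrc : 0 ≤ r * cos θ := by positivity
    have hrc1 : r * cos θ ≤ r := by nlinarith
    rw [angularDensity, max_eq_right (by linarith), ← hm, mul_pow]
    have h1 : (1 + r * cos θ) ^ 2 ≤ 1 + (r + 2) * (r * cos θ) := by nlinarith
    have h2 : m ^ 2 ≤ (1 + sin θ) ^ 2 := by gcongr
    nlinarith [mul_le_mul_of_nonneg_right h1 (sq_nonneg m)]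
  have hd1 : ∀ θ ∈ uIcc (-(π / 2)) 0, HasDerivAt (fun θ ↦ 3 / 2 * θ - 2 * cos θ -
      sin θ * cos θ / 2) ((1 + sin θ) ^ 2) θ := fun θ _ ↦ by
    have s := hasDerivAt_sin θ
    have c := hasDerivAt_cos θ
    refine ((((hasDerivAt_id' θ).const_mul (3 / 2)).sub (c.const_mul 2)).sub
      ((s.mul c).div_const 2)).congr_deriv ?_
    linear_combination (-1 / 2 : ℝ) * sin_sq_add_cos_sq θ
  have hd2 : ∀ θ ∈ uIcc (-(π / 2)) 0, HasDerivAt (fun θ ↦ max 0 (1 + r * sin θ) ^ 3 / 3)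
      (max 0 (1 + r * sin θ) ^ 2 * (r * cos θ)) θ := fun θ _ ↦ by
    have h := (hasDerivAt_max_zero_pow_three (1 + r * sin θ)).comp θ
      (((hasDerivAt_sin θ).const_mul r).const_add 1)
    refine (h.div_const 3).congr_deriv ?_
    ring
  have c1 : Continuous fun θ ↦ (1 + sin θ) ^ 2 := by fun_prop
  have c2 : Continuous fun θ ↦ max 0 (1 + r * sin θ) ^ 2 * (r * cos θ) := by fun_prop
  have c4 : Continuous fun θ ↦ (r + 2) * (max 0 (1 + r * sin θ) ^ 2 * (r * cos θ)) := by fun_prop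
  have c3 : Continuous fun θ ↦ (1 + sin θ) ^ 2 +
      (r + 2) * (max 0 (1 + r * sin θ) ^ 2 * (r * cos θ)) := by fun_prop
  refine (intervalIntegral.integral_mono_on (by linarith [Real.pi_pos])
    ((continuous_angularDensity r).intervalIntegrable _ _)
    (c3.intervalIntegrable _ _) hle).trans ?_
  rw [intervalIntegral.integral_add (c1.intervalIntegrable _ _)
    (c4.intervalIntegrable _ _), intervalIntegral.integral_const_mul,
    intervalIntegral.integral_eq_sub_of_hasDerivAt hd1 (c1.intervalIntegrable _ _),
    intervalIntegral.integral_eq_sub_of_hasDerivAt hd2 (c2.intervalIntegrable _ _)]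
  have : max 0 (1 + -r) = 0 := max_eq_left (by linarith)
  simp [this]
  linarith

lemma integral_angularDensity_second (r : ℝ) :
    ∫ θ in (π / 2)..π, angularDensity r θ = ∫ θ in (-(π / 2))..0, angularDensity r θ := by
  have h := intervalIntegral.integral_comp_sub_left (a := π / 2) (b := π) (angularDensity r) (π / 2)
  rw [sub_self, show π / 2 - π = -(π / 2) by ring] at h
  rw [← h]
  refine intervalIntegral.integral_congr fun θ _ ↦ ?_
  simp only [angularDensity, cos_pi_div_two_sub, sin_pi_div_two_sub]
  rw [mul_comm]

lemma integral_angularDensity_third (r : ℝ) (hr : 1 ≤ r) :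
    ∫ θ in (-π)..(-(π / 2)), angularDensity r θ ≤ π / 200 := by
  have hle : ∀ θ ∈ Icc (-π) (-(π / 2)), angularDensity r θ ≤ 1 / 100 := fun θ hθ ↦ by
    have hs : sin θ ≤ 0 := sin_nonpos_of_nonpos_of_neg_pi_le (by linarith [hθ.2, Real.pi_pos]) hθ.1
    have hc : cos θ ≤ 0 := by
      rw [← cos_neg]
      exact cos_nonpos_of_pi_div_two_le_of_le (by linarith [hθ.2])
        (by linarith [hθ.1, Real.pi_pos])
    have hc1 := neg_one_le_cos θ
    have hs1 := neg_one_le_sin θ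
    have hm1 : max 0 (1 + r * sin θ) ≤ 1 + sin θ := max_le (by linarith) (by nlinarith)
    have hm2 : max 0 (1 + r * cos θ) ≤ 1 + cos θ := max_le (by linarith) (by nlinarith)
    have h1 : max 0 (1 + r * cos θ) * max 0 (1 + r * sin θ) ≤ (1 + cos θ) * (1 + sin θ) :=
      mul_le_mul hm2 hm1 (le_max_left _ _) (by linarith)
    have h2 : (1 + cos θ) * (1 + sin θ) ≤ 1 / 10 := by
      have e := sin_sq_add_cos_sq θ
      -- With `σ = -(cos θ + sin θ)`, which lies in `[1, √2]`, the product equals `(σ - 1)² / 2`.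
      have hσ : -(cos θ + sin θ) ≤ 1.42 := by nlinarith [sq_nonneg (cos θ - sin θ)]
      have hσ1 : 1 ≤ -(cos θ + sin θ) := by nlinarith
      nlinarith
    have h0 : 0 ≤ max 0 (1 + r * cos θ) * max 0 (1 + r * sin θ) :=
      mul_nonneg (le_max_left _ _) (le_max_left _ _)
    rw [angularDensity]
    nlinarith
  refine (intervalIntegral.integral_mono_on (by linarith [Real.pi_pos])
    ((continuous_angularDensity r).intervalIntegrable _ _)
    (continuous_const.intervalIntegrable _ _) hle).trans ?_
  rw [intervalIntegral.integral_const, smul_eq_mul]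
  linarith

/-- The four quarter-circles are added, the second and fourth being mirror images in the diagonal.
The decimals round up the resulting coefficients, such as `2π + π/200 - 8/3` for the constant one.
-/
lemma integral_angularDensity_le (r : ℝ) (hr : 1 ≤ r) :
    ∫ θ in (-π)..π, angularDensity r θ ≤
      3.633 + 14 / 3 * r + 3.5709 * r ^ 2 + 4 / 3 * r ^ 3 + 0.19636 * r ^ 4 := by
  have hi : ∀ a b, IntervalIntegrable (angularDensity r) volume a b := fun a b ↦
    (continuous_angularDensity r).intervalIntegrable a b
  rw [← intervalIntegral.integral_add_adjacent_intervals (hi (-π) (-(π / 2))) (hi _ π),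
    ← intervalIntegral.integral_add_adjacent_intervals (hi (-(π / 2)) 0) (hi _ π),
    ← intervalIntegral.integral_add_adjacent_intervals (hi 0 (π / 2)) (hi _ π),
    integral_angularDensity_second, integral_angularDensity_first r hr]
  have h3 := integral_angularDensity_third r hr
  have h4 := integral_angularDensity_fourth r hr
  have hp := Real.pi_lt_d4
  have h5 : π / 2 * r ^ 2 ≤ 3.1416 / 2 * r ^ 2 := by gcongr
  have h6 : π / 16 * r ^ 4 ≤ 3.1416 / 16 * r ^ 4 := by gcongr
  nlinarith [sq_nonneg r, sq_nonneg (r ^ 2)]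

/-! ### Radial integrals -/

lemma integrableOn_one_div_one_add_pow {k : ℕ} (hk : 0 < k) :
    IntegrableOn (fun r : ℝ ↦ 1 / (1 + r) ^ (k + 1)) (Ioi 1) ∧
      ∫ r in Ioi (1 : ℝ), 1 / (1 + r) ^ (k + 1) = 1 / (k * 2 ^ k) := by
  have hk' : (k : ℝ) ≠ 0 := by exact_mod_cast hk.ne'
  have hd : ∀ r : ℝ, 0 < 1 + r →
      HasDerivAt (fun r : ℝ ↦ -((k : ℝ)⁻¹ * ((1 + r) ^ k)⁻¹)) (1 / (1 + r) ^ (k + 1)) r := by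
    intro r hr
    have h1 : HasDerivAt (fun r : ℝ ↦ (1 + r) ^ k) (k * (1 + r) ^ (k - 1)) r := by
      simpa using ((hasDerivAt_id' r).const_add 1).fun_pow k
    refine (((h1.inv (by positivity)).const_mul (k : ℝ)⁻¹).neg).congr_deriv ?_
    obtain ⟨m, rfl⟩ := Nat.exists_eq_succ_of_ne_zero hk.ne'
    simp only [Nat.succ_eq_add_one, Nat.add_sub_cancel]
    field_simp
    ring
  have ht : Tendsto (fun r : ℝ ↦ -((k : ℝ)⁻¹ * ((1 + r) ^ k)⁻¹)) atTop (𝓝 0) := by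
    have h1 : Tendsto (fun r : ℝ ↦ (1 + r) ^ k) atTop atTop :=
      (tendsto_pow_atTop hk.ne').comp (tendsto_atTop_add_const_left _ 1 tendsto_id)
    simpa using (h1.inv_tendsto_atTop.const_mul (k : ℝ)⁻¹).neg
  have hc : ContinuousWithinAt (fun r : ℝ ↦ -((k : ℝ)⁻¹ * ((1 + r) ^ k)⁻¹)) (Ici 1) 1 :=
    (hd 1 (by norm_num)).continuousAt.continuousWithinAt
  have hd' : ∀ r ∈ Ioi (1 : ℝ), HasDerivAt (fun r : ℝ ↦ -((k : ℝ)⁻¹ * ((1 + r) ^ k)⁻¹))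
      (1 / (1 + r) ^ (k + 1)) r := fun r hr ↦ hd r (by linarith [mem_Ioi.1 hr])
  have hn : ∀ r ∈ Ioi (1 : ℝ), 0 ≤ 1 / (1 + r) ^ (k + 1) := fun r hr ↦ by
    have := mem_Ioi.1 hr
    positivity
  refine ⟨integrableOn_Ioi_deriv_of_nonneg hc hd' hn ht, ?_⟩
  rw [integral_Ioi_of_hasDerivAt_of_nonneg hc hd' hn ht]
  norm_num
  field_simp

lemma integrableOn_radial_and_integral_le :
    IntegrableOn (fun r : ℝ ↦ r * (4096 / (1 + r) ^ 10) *
      (3.633 + 14 / 3 * r + 3.5709 * r ^ 2 + 4 / 3 * r ^ 3 + 0.19636 * r ^ 4)) (Ioi 1) ∧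
    ∫ r in Ioi (1 : ℝ), r * (4096 / (1 + r) ^ 10) *
      (3.633 + 14 / 3 * r + 3.5709 * r ^ 2 + 4 / 3 * r ^ 3 + 0.19636 * r ^ 4) ≤ 23.75 := by
  set f : ℕ → ℝ → ℝ := fun k r ↦ 1 / (1 + r) ^ (k + 1)
  have hi : ∀ k, 0 < k → ∀ c : ℝ, IntegrableOn (fun r ↦ c * f k r) (Ioi 1) := fun k hk c ↦
    (integrableOn_one_div_one_add_pow hk).1.const_mul c
  have hv : ∀ k, 0 < k → ∀ c : ℝ, ∫ r in Ioi (1 : ℝ), c * f k r = c * (1 / (k * 2 ^ k)) :=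
    fun k hk c ↦ by rw [integral_const_mul, (integrableOn_one_div_one_add_pow hk).2]
  -- The numerator, apart from the factor `4096`, is expanded in powers of `1 + r`; the rational
  -- coefficients are those of this expansion.
  have e : EqOn (fun r : ℝ ↦ r * (4096 / (1 + r) ^ 10) *
      (3.633 + 14 / 3 * r + 3.5709 * r ^ 2 + 4 / 3 * r ^ 3 + 0.19636 * r ^ 4))
      (fun r ↦ 4096 * (-70013 / 50000) * f 9 r +
        4096 * (793 / 1200) * f 8 r +
        4096 * (-289 / 30000) * f 7 r +
        4096 * (1207 / 6000) * f 6 r +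
        4096 * (5273 / 15000) * f 5 r +
        4096 * (4909 / 25000) * f 4 r) (Ioi 1) := by
    intro r hr
    have : 1 + r ≠ 0 := by have := mem_Ioi.1 hr; positivity
    simp only [f]
    field_simp
    ring
  have i1 := hi 9 (by norm_num) (4096 * (-70013 / 50000))
  have i2 : IntegrableOn (fun r ↦ 4096 * (-70013 / 50000) * f 9 r +
      4096 * (793 / 1200) * f 8 r) (Ioi 1) :=
    i1.add (hi 8 (by norm_num) _)
  have i3 : IntegrableOn (fun r ↦ 4096 * (-70013 / 50000) * f 9 r +
      4096 * (793 / 1200) * f 8 r +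
      4096 * (-289 / 30000) * f 7 r) (Ioi 1) :=
    i2.add (hi 7 (by norm_num) _)
  have i4 : IntegrableOn (fun r ↦ 4096 * (-70013 / 50000) * f 9 r +
      4096 * (793 / 1200) * f 8 r +
      4096 * (-289 / 30000) * f 7 r +
      4096 * (1207 / 6000) * f 6 r) (Ioi 1) :=
    i3.add (hi 6 (by norm_num) _)
  have i5 : IntegrableOn (fun r ↦ 4096 * (-70013 / 50000) * f 9 r +
      4096 * (793 / 1200) * f 8 r +
      4096 * (-289 / 30000) * f 7 r +
      4096 * (1207 / 6000) * f 6 r +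
      4096 * (5273 / 15000) * f 5 r) (Ioi 1) :=
    i4.add (hi 5 (by norm_num) _)
  have i6 : IntegrableOn (fun r ↦ 4096 * (-70013 / 50000) * f 9 r +
      4096 * (793 / 1200) * f 8 r +
      4096 * (-289 / 30000) * f 7 r +
      4096 * (1207 / 6000) * f 6 r +
      4096 * (5273 / 15000) * f 5 r +
      4096 * (4909 / 25000) * f 4 r) (Ioi 1) :=
    i5.add (hi 4 (by norm_num) _)
  refine ⟨i6.congr_fun e.symm measurableSet_Ioi, ?_⟩
  rw [setIntegral_congr_fun measurableSet_Ioi e,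
    integral_add i5 (hi 4 (by norm_num) _), integral_add i4 (hi 5 (by norm_num) _),
    integral_add i3 (hi 6 (by norm_num) _), integral_add i2 (hi 7 (by norm_num) _),
    integral_add i1 (hi 8 (by norm_num) _), hv 9 (by norm_num), hv 8 (by norm_num),
    hv 7 (by norm_num), hv 6 (by norm_num), hv 5 (by norm_num), hv 4 (by norm_num)]
  norm_num

/-! ### Integration in polar coordinates about the centre -/

/-- The general space serves both `ℂ` with its Euclidean norm and `ℝ × ℝ` with the sup norm. -/
lemma integrable_one_div_one_add_norm_sub_pow_six {E : Type*} [NormedAddCommGroup E]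
    [NormedSpace ℝ E] [FiniteDimensional ℝ E] [MeasurableSpace E] [BorelSpace E] (μ : Measure E)
    [μ.IsAddHaarMeasure] (hE : Module.finrank ℝ E = 2) (a : E) :
    Integrable (fun x ↦ 1 / (1 + ‖x - a‖) ^ 6) μ := by
  have h : Integrable (fun x : E ↦ (1 + ‖x‖) ^ (-(6 : ℝ))) μ :=
    integrable_one_add_norm (by rw [hE]; norm_num)
  refine (h.comp_sub_right a).congr (Eventually.of_forall fun x ↦ ?_)
  simp only
  rw [rpow_neg (by positivity), one_div, show (6 : ℝ) = ((6 : ℕ) : ℝ) by norm_num, rpow_natCast]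

/-- Polar coordinates about a point. -/
lemma integral_eq_integral_polar {f : ℂ → ℝ} (hm : Measurable f) (hf : Integrable f) (c : ℂ) :
    ∫ z, f z = ∫ r in Ioi (0 : ℝ), ∫ θ in (-π)..π,
      r * f (c + (r * cos θ : ℝ) + (r * sin θ : ℝ) * Complex.I) := by
  set F : ℂ → ℝ := fun z ↦ f (c + z)
  have hFm : Measurable F := hm.comp (measurable_const_add c)
  have hF : Integrable F := hf.comp_add_left c
  have e1 : ∫ z, f z = ∫ z, F z := (integral_add_left_eq_self f c).symm
  have htgt : polarCoord.target = Ioi (0 : ℝ) ×ˢ Ioo (-π) π := rfl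
  have hcont : Continuous fun p : ℝ × ℝ ↦ Complex.polarCoord.symm p := by
    have : (fun p : ℝ × ℝ ↦ Complex.polarCoord.symm p) =
        fun p ↦ (p.1 : ℂ) * (cos p.2 + sin p.2 * Complex.I) := by
      funext p; rw [Complex.polarCoord_symm_apply]
    rw [this]; fun_prop
  have hmeas : Measurable fun p : ℝ × ℝ ↦ p.1 * F (Complex.polarCoord.symm p) :=
    measurable_fst.mul (hFm.comp hcont.measurable)
  have hint : IntegrableOn (fun p : ℝ × ℝ ↦ p.1 * F (Complex.polarCoord.symm p))
      (Ioi (0 : ℝ) ×ˢ Ioo (-π) π) := by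
    refine ⟨hmeas.aestronglyMeasurable, ?_⟩
    have h2 : ∫⁻ p in Ioi (0 : ℝ) ×ˢ Ioo (-π) π, ‖p.1 * F (Complex.polarCoord.symm p)‖ₑ =
        ∫⁻ z, ‖F z‖ₑ := by
      rw [← Complex.lintegral_comp_polarCoord_symm, htgt]
      refine setLIntegral_congr_fun (measurableSet_Ioi.prod measurableSet_Ioo) fun p hp ↦ ?_
      simp only [enorm_mul, smul_eq_mul]
      rw [Real.enorm_of_nonneg (le_of_lt hp.1)]
    rw [HasFiniteIntegral, h2]
    exact hF.2
  rw [e1, ← Complex.integral_comp_polarCoord_symm, htgt]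
  simp only [smul_eq_mul]
  rw [Measure.volume_eq_prod, setIntegral_prod _ (by rwa [← Measure.volume_eq_prod])]
  refine setIntegral_congr_fun measurableSet_Ioi fun r _ ↦ ?_
  simp only
  rw [intervalIntegral.integral_of_le (by linarith [Real.pi_pos]), integral_Ioc_eq_integral_Ioo]
  refine setIntegral_congr_fun measurableSet_Ioo fun θ _ ↦ ?_
  simp only [F, Complex.polarCoord_symm_apply]
  congr 2
  push_cast
  ring

section Polar

variable (r θ : ℝ)

lemma polar_re : ((⟨1, 1⟩ : ℂ) + (r * cos θ : ℝ) + (r * sin θ : ℝ) * Complex.I).re =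
    1 + r * cos θ := by
  simp only [Complex.add_re, Complex.mul_re, Complex.ofReal_re, Complex.ofReal_im, Complex.I_re,
    Complex.I_im]
  ring

lemma polar_im : ((⟨1, 1⟩ : ℂ) + (r * cos θ : ℝ) + (r * sin θ : ℝ) * Complex.I).im =
    1 + r * sin θ := by
  simp only [Complex.add_im, Complex.mul_im, Complex.ofReal_re, Complex.ofReal_im, Complex.I_re,
    Complex.I_im]
  ring

lemma norm_polar {r : ℝ} (hr : 0 ≤ r) :
    ‖((⟨1, 1⟩ : ℂ) + (r * cos θ : ℝ) + (r * sin θ : ℝ) * Complex.I) - ⟨1, 1⟩‖ = r := by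
  have h := normSq_sub_center ((⟨1, 1⟩ : ℂ) + (r * cos θ : ℝ) + (r * sin θ : ℝ) * Complex.I)
  rw [polar_re, polar_im] at h
  have h2 : (1 + r * cos θ - 1) ^ 2 + (1 + r * sin θ - 1) ^ 2 = r ^ 2 := by
    linear_combination r ^ 2 * sin_sq_add_cos_sq θ
  rw [h2] at h
  exact (pow_left_inj₀ (norm_nonneg _) hr two_ne_zero).1 h

end Polar

/-- `∫ |z|²` over the hole. -/
lemma integral_ball_re_sq_add_im_sq :
    ∫ z in ball (⟨1, 1⟩ : ℂ) 1, (z.re ^ 2 + z.im ^ 2) = 5 * π / 2 := by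
  have hb : MeasurableSet (ball (⟨1, 1⟩ : ℂ) 1) := measurableSet_ball
  rw [← integral_indicator hb]
  have hc : Continuous fun z : ℂ ↦ z.re ^ 2 + z.im ^ 2 := by fun_prop
  have hi : Integrable ((ball (⟨1, 1⟩ : ℂ) 1).indicator fun z : ℂ ↦ z.re ^ 2 + z.im ^ 2) :=
    ((hc.continuousOn.integrableOn_compact (isCompact_closedBall (⟨1, 1⟩ : ℂ) 1)).mono_set
      ball_subset_closedBall).integrable_indicator hb
  rw [integral_eq_integral_polar (hc.measurable.indicator hb) hi ⟨1, 1⟩]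
  have h1 : ∀ r ∈ Ioi (0 : ℝ), ∫ θ in (-π)..π, r * (ball (⟨1, 1⟩ : ℂ) 1).indicator
      (fun z : ℂ ↦ z.re ^ 2 + z.im ^ 2) (⟨1, 1⟩ + (r * cos θ : ℝ) + (r * sin θ : ℝ) * Complex.I) =
      (Ioo (0 : ℝ) 1).indicator (fun r ↦ 4 * π * r + 2 * π * r ^ 3) r := by
    intro r hr
    have hr0 : 0 ≤ r := le_of_lt hr
    by_cases hr1 : r < 1
    · rw [indicator_of_mem (show r ∈ Ioo (0 : ℝ) 1 from ⟨hr, hr1⟩)]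
      have e : ∀ θ, (ball (⟨1, 1⟩ : ℂ) 1).indicator (fun z : ℂ ↦ z.re ^ 2 + z.im ^ 2)
          (⟨1, 1⟩ + (r * cos θ : ℝ) + (r * sin θ : ℝ) * Complex.I) =
          (2 + r ^ 2) + 2 * r * (cos θ + sin θ) := fun θ ↦ by
        rw [indicator_of_mem, polar_re, polar_im]
        · linear_combination r ^ 2 * sin_sq_add_cos_sq θ
        · rw [mem_ball, dist_eq_norm, norm_polar θ hr0]; exact hr1
      simp only [e]
      have hd : ∀ θ ∈ uIcc (-π) π, HasDerivAt
          (fun θ ↦ r * ((2 + r ^ 2) * θ + 2 * r * (sin θ - cos θ)))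
          (r * ((2 + r ^ 2) + 2 * r * (cos θ + sin θ))) θ := fun θ _ ↦ by
        refine ((((hasDerivAt_id' θ).const_mul (2 + r ^ 2)).add (((hasDerivAt_sin θ).sub
          (hasDerivAt_cos θ)).const_mul (2 * r))).const_mul r).congr_deriv ?_
        ring
      rw [intervalIntegral.integral_eq_sub_of_hasDerivAt hd
        (Continuous.intervalIntegrable (by fun_prop) _ _)]
      simp
      ring
    · rw [indicator_of_notMem (fun h : r ∈ Ioo (0 : ℝ) 1 ↦ hr1 h.2)]
      have e : ∀ θ, (ball (⟨1, 1⟩ : ℂ) 1).indicator (fun z : ℂ ↦ z.re ^ 2 + z.im ^ 2)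
          (⟨1, 1⟩ + (r * cos θ : ℝ) + (r * sin θ : ℝ) * Complex.I) = 0 := fun θ ↦ by
        rw [indicator_of_notMem]
        rw [mem_ball, dist_eq_norm, norm_polar θ hr0]; exact hr1
      simp only [e, mul_zero, intervalIntegral.integral_zero]
  rw [setIntegral_congr_fun measurableSet_Ioi h1, setIntegral_indicator measurableSet_Ioo,
    inter_eq_right.2 Ioo_subset_Ioi_self, ← integral_Ioc_eq_integral_Ioo,
    ← intervalIntegral.integral_of_le zero_le_one]
  have hd : ∀ r ∈ uIcc (0 : ℝ) 1, HasDerivAt (fun r ↦ 2 * π * r ^ 2 + π / 2 * r ^ 4)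
      (4 * π * r + 2 * π * r ^ 3) r := fun r _ ↦ by
    refine (((hasDerivAt_pow 2 r).const_mul (2 * π)).add
      ((hasDerivAt_pow 4 r).const_mul (π / 2))).congr_deriv ?_
    norm_num; ring
  rw [intervalIntegral.integral_eq_sub_of_hasDerivAt hd
    (Continuous.intervalIntegrable (by fun_prop) _ _)]
  norm_num; ring

/-! ### The term `u² |∇φ|²` -/

/-- `(s t)² |∇f|²` for the radial profile `f = 16 / (1 + r)⁴`, extended by zero. -/
noncomputable def profileDensity (z : ℂ) : ℝ :=
  if 1 < ‖z - ⟨1, 1⟩‖ then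
    (max 0 z.re * max 0 z.im) ^ 2 * (4096 / (1 + ‖z - ⟨1, 1⟩‖) ^ 10) else 0

lemma profileDensity_nonneg (z : ℂ) : 0 ≤ profileDensity z := by
  rw [profileDensity]; split_ifs <;> positivity

lemma measurable_profileDensity : Measurable profileDensity := by
  have h : Measurable fun z : ℂ ↦ ‖z - ⟨1, 1⟩‖ := (measurable_id.sub_const _).norm
  refine Measurable.ite (measurableSet_lt measurable_const h) ?_ measurable_const
  exact (((measurable_const.max Complex.measurable_re).mul
    (measurable_const.max Complex.measurable_im)).pow_const 2).mul
    (measurable_const.div ((h.const_add 1).pow_const 10))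

lemma abs_re_le_one_add (z : ℂ) : |z.re| ≤ 1 + ‖z - ⟨1, 1⟩‖ := by
  have h := Complex.abs_re_le_norm (z - ⟨1, 1⟩)
  have e : z.re = 1 + (z - ⟨1, 1⟩).re := by simp
  rw [e]
  exact (abs_add_le _ _).trans (by rw [abs_one]; linarith)

lemma abs_im_le_one_add (z : ℂ) : |z.im| ≤ 1 + ‖z - ⟨1, 1⟩‖ := by
  have h := Complex.abs_im_le_norm (z - ⟨1, 1⟩)
  have e : z.im = 1 + (z - ⟨1, 1⟩).im := by simp
  rw [e]
  exact (abs_add_le _ _).trans (by rw [abs_one]; linarith)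

lemma integrable_profileDensity : Integrable profileDensity := by
  refine ((integrable_one_div_one_add_norm_sub_pow_six volume Complex.finrank_real_complex
    (⟨1, 1⟩ : ℂ)).const_mul 4096).mono' measurable_profileDensity.aestronglyMeasurable
    (Eventually.of_forall fun z ↦ ?_)
  rw [Real.norm_of_nonneg (profileDensity_nonneg z), profileDensity]
  have h1 := abs_re_le_one_add z
  have h2 := abs_im_le_one_add z
  set r := ‖z - ⟨1, 1⟩‖
  have hr : 0 ≤ r := norm_nonneg _
  split_ifs
  swap
  · positivity
  have h3 : max 0 z.re ≤ 1 + r := max_le (by positivity) ((le_abs_self _).trans h1)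
  have h4 : max 0 z.im ≤ 1 + r := max_le (by positivity) ((le_abs_self _).trans h2)
  have h5 : (max 0 z.re * max 0 z.im) ^ 2 ≤ ((1 + r) * (1 + r)) ^ 2 := by
    gcongr
  calc _ ≤ ((1 + r) * (1 + r)) ^ 2 * (4096 / (1 + r) ^ 10) := by gcongr
    _ = _ := by field_simp

lemma integral_profileDensity_le : ∫ z, profileDensity z ≤ 23.75 := by
  rw [integral_eq_integral_polar measurable_profileDensity integrable_profileDensity ⟨1, 1⟩]
  have h1 : ∀ r ∈ Ioi (0 : ℝ), ∫ θ in (-π)..π, r * profileDensity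
      (⟨1, 1⟩ + (r * cos θ : ℝ) + (r * sin θ : ℝ) * Complex.I) =
      (Ioi (1 : ℝ)).indicator (fun r ↦ r * (4096 / (1 + r) ^ 10) *
        ∫ θ in (-π)..π, angularDensity r θ) r := by
    intro r hr
    have hr0 : 0 ≤ r := le_of_lt hr
    by_cases hr1 : 1 < r
    · rw [indicator_of_mem (show r ∈ Ioi (1 : ℝ) from hr1), ← intervalIntegral.integral_const_mul]
      refine intervalIntegral.integral_congr fun θ _ ↦ ?_
      simp only [profileDensity, norm_polar θ hr0, polar_re, polar_im, if_pos hr1, angularDensity]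
      ring
    · rw [indicator_of_notMem (fun h : r ∈ Ioi (1 : ℝ) ↦ hr1 h)]
      simp only [profileDensity, norm_polar _ hr0, if_neg hr1, mul_zero,
        intervalIntegral.integral_zero]
  rw [setIntegral_congr_fun measurableSet_Ioi h1, setIntegral_indicator measurableSet_Ioi,
    inter_eq_right.2 (Ioi_subset_Ioi zero_le_one)]
  obtain ⟨hi, hle⟩ := integrableOn_radial_and_integral_le
  refine le_trans ?_ hle
  refine integral_mono_of_nonneg ?_ hi ?_
  · filter_upwards [ae_restrict_mem measurableSet_Ioi] with r hr
    have : 0 < r := zero_lt_one.trans hr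
    have hA : 0 ≤ ∫ θ in (-π)..π, angularDensity r θ :=
      intervalIntegral.integral_nonneg (by linarith [Real.pi_pos]) fun θ _ ↦ sq_nonneg _
    simp only [Pi.zero_apply]
    positivity
  · filter_upwards [ae_restrict_mem measurableSet_Ioi] with r hr
    have : 0 < r := zero_lt_one.trans hr
    exact mul_le_mul_of_nonneg_left (integral_angularDensity_le r (le_of_lt hr)) (by positivity)

/-! ### The divergence term -/

/-- Distance from `(s, t)` to the centre `(1, 1)` of the hole. -/
noncomputable def centerDist (s t : ℝ) : ℝ := √((s - 1) ^ 2 + (t - 1) ^ 2)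

lemma centerDist_comm (s t : ℝ) : centerDist s t = centerDist t s := by
  rw [centerDist, centerDist, add_comm]

lemma centerDist_nonneg (s t : ℝ) : 0 ≤ centerDist s t := sqrt_nonneg _

lemma centerDist_re_im (z : ℂ) : centerDist z.re z.im = ‖z - ⟨1, 1⟩‖ := by
  rw [centerDist, ← normSq_sub_center, sqrt_sq (norm_nonneg _)]

lemma abs_sub_one_le_centerDist (s t : ℝ) : |s - 1| ≤ centerDist s t := by
  rw [centerDist, ← sqrt_sq_eq_abs]
  exact sqrt_le_sqrt (by nlinarith [sq_nonneg (t - 1)])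

lemma continuous_centerDist : Continuous fun p : ℝ × ℝ ↦ centerDist p.1 p.2 := by
  unfold centerDist; fun_prop

/-- The square of the radial profile `16 / (1 + r)⁴`, extended by `1` to the hole. -/
noncomputable def weight (s t : ℝ) : ℝ := 256 / (1 + max 1 (centerDist s t)) ^ 8

/-- The derivative of `weight` in its first variable. -/
noncomputable def weightDeriv (s t : ℝ) : ℝ :=
  if 1 < centerDist s t then
    -2048 / (1 + centerDist s t) ^ 9 * ((s - 1) / centerDist s t) else 0

/-- `∂_s (s t · t · weight)`. -/
noncomputable def flux (s t : ℝ) : ℝ := t ^ 2 * (weight s t + s * weightDeriv s t)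

lemma continuous_weight : Continuous fun p : ℝ × ℝ ↦ weight p.1 p.2 := by
  unfold weight
  refine continuous_const.div ((continuous_const.add
    (continuous_const.max continuous_centerDist)).pow 8) fun p ↦ ?_
  have : (1 : ℝ) ≤ max 1 (centerDist p.1 p.2) := le_max_left _ _
  positivity

lemma weight_nonneg (s t : ℝ) : 0 ≤ weight s t := by
  have : (1 : ℝ) ≤ max 1 (centerDist s t) := le_max_left _ _
  rw [weight]; positivity

lemma weight_le (s t : ℝ) : weight s t ≤ 256 / (1 + centerDist s t) ^ 8 := by
  have := centerDist_nonneg s t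
  rw [weight]
  gcongr
  exact le_max_right _ _

lemma abs_weightDeriv_le (s t : ℝ) : |weightDeriv s t| ≤ 2048 / (1 + centerDist s t) ^ 9 := by
  have h0 := centerDist_nonneg s t
  rw [weightDeriv]
  split_ifs with h
  · have hp : 0 < centerDist s t := by linarith
    rw [abs_mul, abs_div, abs_div, abs_neg, abs_of_pos (show (0 : ℝ) < 2048 by norm_num),
      abs_of_pos (show 0 < (1 + centerDist s t) ^ 9 by positivity), abs_of_pos hp]
    refine mul_le_of_le_one_right (by positivity) ?_
    rw [div_le_one hp]
    exact abs_sub_one_le_centerDist s t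
  · rw [abs_zero]; positivity

lemma abs_le_one_add_centerDist (s t : ℝ) : |s| ≤ 1 + centerDist s t := by
  have h := abs_sub_one_le_centerDist s t
  have : |s| ≤ 1 + |s - 1| := by
    have := abs_add_le 1 (s - 1)
    rwa [abs_one, add_sub_cancel] at this
  linarith

lemma abs_flux_le (s t : ℝ) : |flux s t| ≤ 2304 * (1 / (1 + centerDist s t) ^ 6) := by
  have h0 := centerDist_nonneg s t
  have h1 := abs_le_one_add_centerDist s t
  have h2 := abs_le_one_add_centerDist t s
  rw [centerDist_comm] at h2
  have h3 := weight_le s t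
  have h4 := abs_weightDeriv_le s t
  have h5 := weight_nonneg s t
  set r := centerDist s t
  have h6 : |weight s t + s * weightDeriv s t| ≤ 256 / (1 + r) ^ 8 + 2048 / (1 + r) ^ 8 := by
    refine (abs_add_le _ _).trans (add_le_add ((abs_of_nonneg h5).trans_le h3) ?_)
    rw [abs_mul]
    calc |s| * |weightDeriv s t| ≤ (1 + r) * (2048 / (1 + r) ^ 9) :=
          mul_le_mul h1 h4 (abs_nonneg _) (by positivity)
      _ = _ := by field_simp
  rw [flux, abs_mul, abs_pow]
  calc |t| ^ 2 * |weight s t + s * weightDeriv s t|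
      ≤ (1 + r) ^ 2 * (256 / (1 + r) ^ 8 + 2048 / (1 + r) ^ 8) := by gcongr
    _ = _ := by field_simp; norm_num

lemma measurable_flux : Measurable fun p : ℝ × ℝ ↦ flux p.1 p.2 := by
  have hr := continuous_centerDist.measurable
  have hd : Measurable fun p : ℝ × ℝ ↦ weightDeriv p.1 p.2 := by
    refine Measurable.ite (measurableSet_lt measurable_const hr) ?_ measurable_const
    exact (measurable_const.div ((hr.const_add 1).pow_const 9)).mul
      ((measurable_fst.sub_const 1).div hr)
  exact (measurable_snd.pow_const 2).mul
    (continuous_weight.measurable.add (measurable_fst.mul hd))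

lemma integrable_flux : Integrable fun p : ℝ × ℝ ↦ flux p.1 p.2 := by
  have hfin : Module.finrank ℝ (ℝ × ℝ) = 2 := by simp
  refine ((integrable_one_div_one_add_norm_sub_pow_six (volume : Measure (ℝ × ℝ)) hfin
    (1, 1)).const_mul 2304).mono' measurable_flux.aestronglyMeasurable
    (Eventually.of_forall fun p ↦ (abs_flux_le p.1 p.2).trans ?_)
  gcongr
  rw [Prod.norm_def]
  refine max_le (abs_sub_one_le_centerDist p.1 p.2) ?_
  rw [centerDist_comm]
  exact abs_sub_one_le_centerDist p.2 p.1

lemma hasDerivAt_weight {s t : ℝ} (h : centerDist s t ≠ 1) :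
    HasDerivAt (fun s ↦ weight s t) (weightDeriv s t) s := by
  have hc : Continuous fun s ↦ centerDist s t :=
    continuous_centerDist.comp (continuous_id.prodMk continuous_const)
  rcases lt_or_gt_of_ne h with h | h
  · have e : (fun s ↦ weight s t) =ᶠ[𝓝 s] fun _ ↦ 256 / (1 + 1) ^ 8 := by
      filter_upwards [(isOpen_lt hc continuous_const).mem_nhds h] with y hy
      rw [weight, max_eq_left (le_of_lt hy)]
    rw [weightDeriv, if_neg h.not_gt]
    exact (hasDerivAt_const s _).congr_of_eventuallyEq e
  · have e : (fun s ↦ weight s t) =ᶠ[𝓝 s] fun s ↦ 256 * ((1 + centerDist s t) ^ 8)⁻¹ := by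
      filter_upwards [(isOpen_lt continuous_const hc).mem_nhds h] with y hy
      rw [weight, max_eq_right (le_of_lt hy), div_eq_mul_inv]
    have hp : 0 < centerDist s t := by linarith
    have hq : (s - 1) ^ 2 + (t - 1) ^ 2 ≠ 0 := by
      intro h0; rw [centerDist, h0, sqrt_zero] at hp; exact lt_irrefl _ hp
    have h1 : HasDerivAt (fun s ↦ centerDist s t) ((s - 1) / centerDist s t) s := by
      have h2 : HasDerivAt (fun s : ℝ ↦ (s - 1) ^ 2 + (t - 1) ^ 2) (2 * (s - 1)) s := by
        simpa using (((hasDerivAt_id' s).sub_const 1).fun_pow 2).add_const ((t - 1) ^ 2)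
      refine (h2.sqrt hq).congr_deriv ?_
      rw [← centerDist]
      field_simp
    rw [weightDeriv, if_pos h]
    have h3 := (((h1.const_add 1).fun_pow 8).fun_inv (by positivity)).const_mul 256
    refine (h3.congr_of_eventuallyEq e).congr_deriv ?_
    field_simp
    norm_num
    ring

/-- `weight` has a corner on the circle, but each horizontal line meets it at most twice, which the
fundamental theorem of calculus tolerates. -/
lemma countable_centerDist_eq_one (t : ℝ) : {s | centerDist s t = 1}.Countable := by
  refine Set.Countable.mono (s₂ := {1 + √(1 - (t - 1) ^ 2), 1 - √(1 - (t - 1) ^ 2)}) ?_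
    (Set.toFinite _).countable
  intro s hs
  have h : centerDist s t = 1 := hs
  rw [centerDist, sqrt_eq_one] at h
  have h1 : √(1 - (t - 1) ^ 2) = |s - 1| := by
    rw [← sqrt_sq_eq_abs]; congr 1; linarith
  simp only [mem_insert_iff, mem_singleton_iff, h1]
  rcases abs_cases (s - 1) with h | h
  · left; linarith
  · right; linarith

lemma continuous_mul_weight (t : ℝ) : Continuous fun s ↦ s * weight s t := by
  have h : Continuous fun s : ℝ ↦ (s, t) := by fun_prop
  have hw := continuous_weight.comp h
  simp only [Function.comp_def] at hw
  exact Continuous.mul continuous_id' hw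

lemma hasDerivAt_mul_weight {s t : ℝ} (h : centerDist s t ≠ 1) :
    HasDerivAt (fun s ↦ s * weight s t) (weight s t + s * weightDeriv s t) s := by
  have h1 := (hasDerivAt_id' s).fun_mul (hasDerivAt_weight h)
  rwa [one_mul] at h1

lemma intervalIntegral_deriv_mul_weight {t R : ℝ} (hR : 0 ≤ R)
    (hi : IntervalIntegrable (fun s ↦ weight s t + s * weightDeriv s t) volume 0 R) :
    ∫ s in (0 : ℝ)..R, (weight s t + s * weightDeriv s t) = R * weight R t := by
  have h := MeasureTheory.integral_eq_of_hasDerivAt_off_countable_of_le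
    (fun s ↦ s * weight s t) (fun s ↦ weight s t + s * weightDeriv s t) hR
    (countable_centerDist_eq_one t) (continuous_mul_weight t).continuousOn
    (fun s hs ↦ hasDerivAt_mul_weight hs.2) hi
  rwa [zero_mul, sub_zero] at h

lemma tendsto_mul_weight (t : ℝ) : Tendsto (fun R : ℝ ↦ R * weight R t) atTop (𝓝 0) := by
  have h4 : Tendsto (fun R : ℝ ↦ 256 * R⁻¹) atTop (𝓝 0) := by
    simpa using tendsto_inv_atTop_zero.const_mul (256 : ℝ)
  refine tendsto_of_tendsto_of_tendsto_of_le_of_le' tendsto_const_nhds h4 ?_ ?_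
  · filter_upwards [eventually_ge_atTop 1] with R hR
    exact mul_nonneg (by linarith) (weight_nonneg _ _)
  · filter_upwards [eventually_ge_atTop 1] with R hR
    have hR0 : 0 < R := by linarith
    have h5 : R ≤ 1 + centerDist R t := (le_abs_self R).trans (abs_le_one_add_centerDist R t)
    have h6 : 256 / (1 + centerDist R t) ^ 8 ≤ 256 / R ^ 8 := by gcongr
    calc R * weight R t ≤ R * (256 / R ^ 8) :=
          mul_le_mul_of_nonneg_left ((weight_le R t).trans h6) hR0.le
      _ = 256 * (R ^ 7)⁻¹ := by field_simp
      _ ≤ 256 * R⁻¹ := by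
          have : R ≤ R ^ 7 := le_self_pow₀ hR (by norm_num)
          gcongr

/-- The primitive `s * weight s t` vanishes at `s = 0` and at infinity. -/
lemma integral_deriv_mul_weight (t : ℝ) :
    ∫ s in Ioi (0 : ℝ), (weight s t + s * weightDeriv s t) = 0 := by
  -- Integrability on each line need not be checked: without it the integral is `0` by convention.
  by_cases hi : IntegrableOn (fun s ↦ weight s t + s * weightDeriv s t) (Ioi 0)
  swap
  · exact integral_undef hi
  have h1 := intervalIntegral_tendsto_integral_Ioi 0 hi tendsto_id
  refine tendsto_nhds_unique h1 ((tendsto_mul_weight t).congr' ?_)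
  filter_upwards [eventually_ge_atTop 0] with R hR
  exact (intervalIntegral_deriv_mul_weight hR ((intervalIntegrable_iff_integrableOn_Ioc_of_le hR).2
    (hi.mono_set Ioc_subset_Ioi_self))).symm

lemma setIntegral_flux_swap :
    ∫ p in Ioi (0 : ℝ) ×ˢ Ioi (0 : ℝ), flux p.2 p.1 = 0 := by
  have hi : Integrable (fun p : ℝ × ℝ ↦ flux p.2 p.1) (volume.prod volume) := by
    have := integrable_flux
    rw [Measure.volume_eq_prod] at this
    exact this.swap
  rw [Measure.volume_eq_prod, setIntegral_prod _ hi.integrableOn]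
  refine integral_eq_zero_of_ae (Eventually.of_forall fun t ↦ ?_)
  simp only [flux, integral_const_mul, integral_deriv_mul_weight, mul_zero, Pi.zero_apply]

lemma setIntegral_flux : ∫ p in Ioi (0 : ℝ) ×ˢ Ioi (0 : ℝ), flux p.1 p.2 = 0 := by
  have := setIntegral_prod_swap (μ := volume) (ν := volume) (Ioi (0 : ℝ)) (Ioi (0 : ℝ))
    fun p : ℝ × ℝ ↦ flux p.1 p.2
  rw [Measure.volume_eq_prod, ← this, ← Measure.volume_eq_prod]
  exact setIntegral_flux_swap

/-- The divergence of `weight · (s t) ∇(s t)`. -/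
noncomputable def divergence (z : ℂ) : ℝ := flux z.re z.im + flux z.im z.re

lemma integrable_flux_re_im : Integrable fun z : ℂ ↦ flux z.re z.im :=
  (Complex.volume_preserving_equiv_real_prod.integrable_comp_emb
    Complex.measurableEquivRealProd.measurableEmbedding).2 integrable_flux

lemma integrable_flux_im_re : Integrable fun z : ℂ ↦ flux z.im z.re := by
  have hi : Integrable (fun p : ℝ × ℝ ↦ flux p.2 p.1) := by
    have := integrable_flux
    rw [Measure.volume_eq_prod] at this ⊢
    exact this.swap
  exact (Complex.volume_preserving_equiv_real_prod.integrable_comp_emb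
    Complex.measurableEquivRealProd.measurableEmbedding).2 hi

lemma integrable_divergence : Integrable divergence :=
  integrable_flux_re_im.add integrable_flux_im_re

lemma setIntegral_quadrant (f : ℝ × ℝ → ℝ) :
    ∫ z in quadrant, f (z.re, z.im) = ∫ p in Ioi (0 : ℝ) ×ˢ Ioi (0 : ℝ), f p :=
  Complex.volume_preserving_equiv_real_prod.setIntegral_preimage_emb
    Complex.measurableEquivRealProd.measurableEmbedding f (Ioi (0 : ℝ) ×ˢ Ioi (0 : ℝ))

lemma setIntegral_quadrant_divergence : ∫ z in quadrant, divergence z = 0 := by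
  unfold divergence
  rw [integral_add integrable_flux_re_im.integrableOn integrable_flux_im_re.integrableOn]
  have h1 := setIntegral_quadrant fun p ↦ flux p.1 p.2
  have h2 := setIntegral_quadrant fun p ↦ flux p.2 p.1
  simp only at h1 h2
  rw [h1, h2, setIntegral_flux, setIntegral_flux_swap, add_zero]

lemma divergence_of_mem_ball {z : ℂ} (hz : z ∈ ball (⟨1, 1⟩ : ℂ) 1) :
    divergence z = z.re ^ 2 + z.im ^ 2 := by
  rw [mem_ball, dist_eq_norm, ← centerDist_re_im] at hz
  have hz' := hz
  rw [centerDist_comm] at hz'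
  rw [divergence, flux, flux, weightDeriv, weightDeriv, if_neg hz.not_gt, if_neg hz'.not_gt,
    weight, weight, max_eq_left hz.le, max_eq_left hz'.le]
  norm_num
  ring

lemma ball_subset_quadrant : ball (⟨1, 1⟩ : ℂ) 1 ⊆ quadrant := fun z hz ↦ by
  rw [mem_ball, dist_eq_norm] at hz
  have h1 := (Complex.abs_re_le_norm (z - ⟨1, 1⟩)).trans_lt hz
  have h2 := (Complex.abs_im_le_norm (z - ⟨1, 1⟩)).trans_lt hz
  rw [abs_lt] at h1 h2
  simp only [Complex.sub_re, Complex.sub_im] at h1 h2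
  exact ⟨by linarith, by linarith⟩

/-- Up to the null circle the quadrant is the disjoint union of `P_1` and the open disc. The total
being zero, the share of `P_1` is minus that of the disc. -/
lemma setIntegral_cellDomain_divergence : ∫ z in cellDomain 1, divergence z = -(5 * π / 2) := by
  have hq : quadrant =ᵐ[volume] (cellDomain 1 ∪ ball (⟨1, 1⟩ : ℂ) 1 : Set ℂ) := by
    have hs : volume (sphere (⟨1, 1⟩ : ℂ) 1) = 0 := Measure.addHaar_sphere volume _ _
    have : ∀ᵐ z : ℂ, z ∉ sphere (⟨1, 1⟩ : ℂ) 1 := measure_eq_zero_iff_ae_notMem.1 hs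
    filter_upwards [this] with z hz
    refine propext ⟨fun h ↦ ?_, fun h ↦ ?_⟩
    · by_cases hb : z ∈ ball (⟨1, 1⟩ : ℂ) 1
      · exact Or.inr hb
      · refine Or.inl ⟨h, fun hc ↦ ?_⟩
        have hc' : z ∈ closedBall (⟨1, 1⟩ : ℂ) 1 := hc
        rw [← ball_union_sphere] at hc'
        exact hc'.elim hb hz
    · exact h.elim (fun h ↦ h.1) fun h ↦ ball_subset_quadrant h
  have hdisj : Disjoint (cellDomain 1) (ball (⟨1, 1⟩ : ℂ) 1) :=
    disjoint_left.2 fun z hz hb ↦ hz.2 (ball_subset_closedBall hb)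
  have h := setIntegral_quadrant_divergence
  rw [setIntegral_congr_set hq, setIntegral_union hdisj measurableSet_ball
    integrable_divergence.integrableOn integrable_divergence.integrableOn,
    setIntegral_congr_fun measurableSet_ball fun z hz ↦ divergence_of_mem_ball hz,
    integral_ball_re_sq_add_im_sq] at h
  linarith

/-! ### The trial function -/

/-- The trial function `s t · 16 / (1 + r)⁴`. -/
noncomputable def trial (z : ℂ) : ℝ := z.re * z.im * (16 * ((1 + ‖z - ⟨1, 1⟩‖) ^ 4)⁻¹)

lemma continuous_trial : Continuous trial := by
  unfold trial
  refine (Complex.continuous_re.mul Complex.continuous_im).mul (continuous_const.mul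
    (Continuous.inv₀ ?_ fun z ↦ by positivity))
  exact (continuous_const.add (continuous_norm.comp (continuous_id.sub continuous_const))).pow 4

lemma contDiffOn_trial : ContDiffOn ℝ 1 trial (cellDomain 1) := by
  intro z hz
  have hz1 := (mem_cellDomain_one.1 hz).2
  have hne : z - ⟨1, 1⟩ ≠ 0 := fun h ↦ by rw [h, norm_zero] at hz1; linarith
  have hn : ContDiffAt ℝ 1 (fun z : ℂ ↦ ‖z - ⟨1, 1⟩‖) z :=
    (contDiffAt_id.sub contDiffAt_const).norm ℝ hne
  have hre : ContDiffAt ℝ 1 (fun z : ℂ ↦ z.re) z := Complex.reCLM.contDiff.contDiffAt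
  have him : ContDiffAt ℝ 1 (fun z : ℂ ↦ z.im) z := Complex.imCLM.contDiff.contDiffAt
  exact ((hre.mul him).mul (contDiffAt_const.mul
    (((contDiffAt_const.add hn).pow 4).inv (by positivity)))).contDiffWithinAt

/-- This is `|∇(uφ)|² = div(φ² u ∇u) + u² |∇φ|²` for harmonic `u = s t`, with `weight` in the role
of `φ²`. -/
lemma gradInner_trial {z : ℂ} (hz : z ∈ cellDomain 1) :
    gradInner trial trial z = divergence z + profileDensity z := by
  obtain ⟨⟨hre, him⟩, hz1⟩ := mem_cellDomain_one.1 hz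
  have hne : z - ⟨1, 1⟩ ≠ 0 := fun h ↦ by rw [h, norm_zero] at hz1; linarith
  have hr2 := normSq_sub_center z
  obtain ⟨L, hL⟩ : DifferentiableAt ℝ (fun z : ℂ ↦ ‖z - ⟨1, 1⟩‖) z :=
    ((contDiffAt_id.sub contDiffAt_const).norm ℝ hne : ContDiffAt ℝ 1
      (fun z : ℂ ↦ ‖z - ⟨1, 1⟩‖) z).differentiableAt one_ne_zero
  have hre' : HasFDerivAt (fun z : ℂ ↦ z.re) Complex.reCLM z := Complex.reCLM.hasFDerivAt
  have him' : HasFDerivAt (fun z : ℂ ↦ z.im) Complex.imCLM z := Complex.imCLM.hasFDerivAt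
  have hsq : ∀ v : ℂ, ‖z - ⟨1, 1⟩‖ * L v = (z.re - 1) * v.re + (z.im - 1) * v.im := by
    have h1 := hL.pow 2
    have h2 : HasFDerivAt (fun z : ℂ ↦ ‖z - ⟨1, 1⟩‖ ^ 2) _ z :=
      (((hre'.sub_const 1).pow 2).add ((him'.sub_const 1).pow 2)).congr_of_eventuallyEq
        (Eventually.of_forall fun w ↦ normSq_sub_center w)
    intro v
    have := congrArg (fun M : ℂ →L[ℝ] ℝ ↦ M v) (h1.unique h2)
    simp at this
    linarith
  have hφ : HasDerivAt (fun r : ℝ ↦ 16 * ((1 + r) ^ 4)⁻¹)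
      (-64 / (1 + ‖z - ⟨1, 1⟩‖) ^ 5) ‖z - ⟨1, 1⟩‖ := by
    have h := (((hasDerivAt_id' ‖z - ⟨1, 1⟩‖).const_add 1).fun_pow 4).fun_inv
      (by positivity) |>.const_mul 16
    refine h.congr_deriv ?_
    have : (0 : ℝ) < 1 + ‖z - ⟨1, 1⟩‖ := by positivity
    field_simp
    norm_num
    ring
  have hφL : HasFDerivAt (fun z : ℂ ↦ 16 * ((1 + ‖z - ⟨1, 1⟩‖) ^ 4)⁻¹)
      ((-64 / (1 + ‖z - ⟨1, 1⟩‖) ^ 5) • L) z :=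
    HasDerivAt.comp_hasFDerivAt (h₂ := fun r : ℝ ↦ 16 * ((1 + r) ^ 4)⁻¹) z hφ hL
  have hV : HasFDerivAt trial _ z := (hre'.fun_mul him').fun_mul hφL
  have hdist := centerDist_re_im z
  have hdist' := hdist
  rw [centerDist_comm] at hdist'
  have e1 := hsq 1
  have e2 := hsq Complex.I
  simp only [Complex.one_re, Complex.one_im, Complex.I_re, Complex.I_im, mul_one, mul_zero,
    add_zero, zero_add] at e1 e2
  rw [gradInner, hV.fderiv, divergence, flux, flux, weightDeriv, weightDeriv, weight, weight,
    profileDensity, hdist, hdist', if_pos hz1, if_pos hz1, if_pos hz1, max_eq_right hz1.le,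
    max_eq_right hre.le, max_eq_right him.le]
  set r := ‖z - ⟨1, 1⟩‖
  have hr : 0 < r := by linarith
  have f1 : L 1 = (z.re - 1) / r := by field_simp; linarith
  have f2 : L Complex.I = (z.im - 1) / r := by field_simp; linarith
  simp [f1, f2]
  have h1r : 0 < 1 + r := by linarith
  field_simp
  linear_combination (-4096) * z.im ^ 2 * z.re ^ 2 * hr2

/-! ### Existence, uniqueness and the energy bound -/

lemma mem_frontier_quadrant_of_notMem {z : ℂ} (hz : z ∈ closure (cellDomain 1))
    (h : z.re * z.im = 0) : z ∈ frontier quadrant := by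
  refine ⟨closure_mono sdiff_subset hz, fun hi ↦ ?_⟩
  have hq := interior_subset hi
  exact (mul_pos hq.1 hq.2).ne' h

lemma re_mul_im_of_mem_frontier_quadrant {z : ℂ} (hz : z ∈ frontier quadrant) :
    z ∉ cellDomain 1 ∧ z.re * z.im = 0 := by
  have hn : z ∉ quadrant := by
    have := hz.2
    rwa [isOpen_quadrant.interior_eq] at this
  refine ⟨fun h ↦ hn h.1, ?_⟩
  obtain ⟨h1, h2⟩ := closure_quadrant_subset hz.1
  by_contra h
  obtain ⟨h3, h4⟩ := mul_ne_zero_iff.1 h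
  exact hn ⟨lt_of_le_of_ne h1 h3.symm, lt_of_le_of_ne h2 h4.symm⟩

lemma frontier_hole_one : frontier (hole 1) = sphere (⟨1, 1⟩ : ℂ) 1 :=
  frontier_closedBall _ one_ne_zero

lemma notMem_cellDomain_of_mem_frontier_hole {z : ℂ} (hz : z ∈ frontier (hole 1)) :
    z ∉ cellDomain 1 := fun h ↦ by
  rw [frontier_hole_one] at hz
  exact h.2 (sphere_subset_closedBall hz)

lemma IsCellFunction.eq_re_mul_im {W : ℂ → ℝ} (hW : IsCellFunction 1 W) {z : ℂ}
    (hz : z ∈ closure (cellDomain 1)) (hzP : z ∉ cellDomain 1) : W z = z.re * z.im := by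
  rcases boundary_cellDomain_one hz hzP with h | h
  · rw [h, hW.eq_zero z (mem_frontier_quadrant_of_notMem hz h)]
  · refine hW.eq_mul z ?_
    rw [frontier_hole_one, mem_sphere, dist_eq_norm, h]

lemma cellDomain_ne_univ (a : ℝ) : cellDomain a ≠ univ := fun h ↦ by
  have : (0 : ℂ) ∈ cellDomain a := h ▸ mem_univ _
  exact lt_irrefl _ this.1.1

theorem IsCellFunction.eqOn {W W' : ℂ → ℝ} (hW : IsCellFunction 1 W)
    (hW' : IsCellFunction 1 W') : EqOn W' W (closure (cellDomain 1)) := by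
  have hP := isOpen_cellDomain 1
  have hb : ∀ z ∈ closure (cellDomain 1), z ∉ cellDomain 1 → W' z - W z = 0 := fun z hz hzP ↦ by
    rw [hW.eq_re_mul_im hz hzP, hW'.eq_re_mul_im hz hzP, sub_self]
  have hharm : HarmonicOnNhd (fun z ↦ W' z - W z) (cellDomain 1) :=
    hW'.harmonicContOnCl.1.sub hW.harmonicContOnCl.1
  have h1 := hW.finite_energy
  have h2 := hW'.finite_energy
  simp only [norm_gradient_sq] at h1 h2
  -- The energy density of the difference is at most twice the sum of the two densities.
  have hE : IntegrableOn (gradInner (fun z ↦ W' z - W z) fun z ↦ W' z - W z) (cellDomain 1) := by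
    have hd : ∀ {f : ℂ → ℝ}, HarmonicOnNhd f (cellDomain 1) → ContDiffOn ℝ 1 f (cellDomain 1) :=
      fun hf z hz ↦ ((hf z hz).1.of_le one_le_two).contDiffWithinAt
    have hda : ∀ {f : ℂ → ℝ}, HarmonicOnNhd f (cellDomain 1) → ∀ z ∈ cellDomain 1,
        DifferentiableAt ℝ f z := fun hf z hz ↦ (hf z hz).1.differentiableAt two_ne_zero
    refine ((h2.add h1).const_mul 2).mono'
      ((continuousOn_gradInner hP (hd hharm) (hd hharm)).aestronglyMeasurable hP.measurableSet)
      ((ae_restrict_iff' hP.measurableSet).2 (Eventually.of_forall fun z hz ↦ ?_))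
    have e1 := hda hW.harmonicContOnCl.1 z hz
    have e2 := hda hW'.harmonicContOnCl.1 z hz
    rw [norm_of_nonneg (gradInner_self_nonneg _ z)]
    simp only [gradInner, fderiv_fun_sub e2 e1, sub_apply, Pi.add_apply]
    nlinarith [sq_nonneg (fderiv ℝ W' z 1 + fderiv ℝ W z 1),
      sq_nonneg (fderiv ℝ W' z Complex.I + fderiv ℝ W z Complex.I)]
  intro z hz
  by_cases hzP : z ∈ cellDomain 1
  · exact sub_eq_zero.1 (eq_zero_of_integrableOn_gradInner hP (cellDomain_ne_univ 1) hharm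
      (hW'.harmonicContOnCl.2.sub hW.harmonicContOnCl.2) hb hE z hzP)
  · exact sub_eq_zero.1 (hb z hz hzP)

lemma trial_eq_re_mul_im {z : ℂ} (hz : z ∈ closure (cellDomain 1)) (hzP : z ∉ cellDomain 1) :
    trial z = z.re * z.im := by
  rcases boundary_cellDomain_one hz hzP with h | h
  · rw [trial, h, zero_mul]
  · rw [trial, h]; norm_num

lemma abs_trial_le (z : ℂ) : |trial z| ≤ 16 / (1 + ‖z - ⟨1, 1⟩‖) ^ 2 := by
  have h1 := abs_re_le_one_add z
  have h2 := abs_im_le_one_add z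
  have h0 := norm_nonneg (z - ⟨1, 1⟩)
  set r := ‖z - ⟨1, 1⟩‖
  rw [trial, abs_mul, abs_mul, abs_of_nonneg (show 0 ≤ 16 * ((1 + r) ^ 4)⁻¹ by positivity)]
  calc |z.re| * |z.im| * (16 * ((1 + r) ^ 4)⁻¹)
      ≤ (1 + r) * (1 + r) * (16 * ((1 + r) ^ 4)⁻¹) := by gcongr
    _ = _ := by field_simp

lemma integrableOn_gradInner_trial : IntegrableOn (gradInner trial trial) (cellDomain 1) :=
  ((integrable_divergence.add integrable_profileDensity).integrableOn).congr_fun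
    (fun _ hz ↦ (gradInner_trial hz).symm) (isOpen_cellDomain 1).measurableSet

lemma integral_gradInner_trial_le :
    ∫ z in cellDomain 1, gradInner trial trial z ≤ 23.75 - 5 * π / 2 := by
  rw [setIntegral_congr_fun (isOpen_cellDomain 1).measurableSet fun z hz ↦ gradInner_trial hz,
    integral_add integrable_divergence.integrableOn integrable_profileDensity.integrableOn,
    setIntegral_cellDomain_divergence]
  have := (setIntegral_le_integral (s := cellDomain 1) integrable_profileDensity
    (Eventually.of_forall profileDensity_nonneg)).trans integral_profileDensity_le
  linarith

theorem exists_isCellFunction_one : ∃ W, IsCellFunction 1 W ∧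
    dirichletEnergy (cellDomain 1) W ≤ 23.75 - 5 * π / 2 := by
  obtain ⟨W, hW, hb, hle⟩ := exists_harmonicContOnCl_cellDomain_one
  have hdecay : ∀ z, |W z - trial z| ≤ 128 / ‖z‖ ^ 2 + 16 / (1 + ‖z - ⟨1, 1⟩‖) ^ 2 ∨
      z ∉ cellDomain 1 := by
    intro z
    by_cases hz : z ∈ cellDomain 1
    swap
    · exact Or.inr hz
    refine Or.inl ((abs_sub _ _).trans (add_le_add ?_ (abs_trial_le z)))
    obtain ⟨h1, h2⟩ := hle z hz
    have hq : 0 < ‖z‖ := norm_pos_iff.2 fun h ↦ by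
      have := hz.1.1
      rw [h] at this
      exact lt_irrefl _ this
    rw [abs_of_nonneg h1]
    refine h2.trans ?_
    have h3 : z.re * z.im ≤ ‖z‖ ^ 2 / 2 := by
      rw [norm_sq_eq_re_im]; nlinarith [sq_nonneg (z.re - z.im)]
    calc 256 * (z.re * z.im / (‖z‖ ^ 2) ^ 2) ≤ 256 * (‖z‖ ^ 2 / 2 / (‖z‖ ^ 2) ^ 2) := by gcongr
      _ = _ := by field_simp; norm_num
  have hinf : ∀ ε > 0, ∃ R, ∀ z ∈ closure (cellDomain 1), ε ≤ |W z - trial z| → ‖z‖ ≤ R := by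
    intro ε hε
    -- Here `192 = 128 + 64`: `W` is at most `128 / |z|²` because `s t ≤ |z|² / 2`, and for `|z| >
    -- 4` the trial function is at most `64 / |z|²` because `1 + r ≥ |z| / 2`.
    refine ⟨max 4 (√(192 / ε)), fun z hz h ↦ ?_⟩
    by_contra hR
    push Not at hR
    obtain ⟨hR1, hR2⟩ := max_lt_iff.1 hR
    rcases hdecay z with hd | hd
    swap
    · rw [hb z hd, trial_eq_re_mul_im hz hd, sub_self, abs_zero] at h
      linarith
    have hc : ‖(⟨1, 1⟩ : ℂ)‖ ≤ 2 := by
      have := norm_sq_eq_re_im (⟨1, 1⟩ : ℂ)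
      have h0 := norm_nonneg (⟨1, 1⟩ : ℂ)
      norm_num at this
      nlinarith
    have hr : ‖z‖ - 2 ≤ ‖z - ⟨1, 1⟩‖ := by linarith [norm_sub_norm_le z ⟨1, 1⟩]
    have h3 : 16 / (1 + ‖z - ⟨1, 1⟩‖) ^ 2 ≤ 64 / ‖z‖ ^ 2 := by
      have : ‖z‖ / 2 ≤ 1 + ‖z - ⟨1, 1⟩‖ := by linarith
      calc 16 / (1 + ‖z - ⟨1, 1⟩‖) ^ 2 ≤ 16 / (‖z‖ / 2) ^ 2 := by gcongr
        _ = _ := by field_simp; norm_num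
    have h4 : ε ≤ 192 / ‖z‖ ^ 2 := by
      refine (h.trans hd).trans ?_
      calc _ ≤ 128 / ‖z‖ ^ 2 + 64 / ‖z‖ ^ 2 := by gcongr
        _ = _ := by ring
    have h5 : 192 / ε < ‖z‖ ^ 2 := (sqrt_lt' (by linarith)).1 hR2
    rw [le_div_iff₀ (by positivity)] at h4
    rw [div_lt_iff₀ hε] at h5
    linarith
  obtain ⟨hE, hle'⟩ := dirichlet_principle (isOpen_cellDomain 1) hW.1 contDiffOn_trial
    (hW.2.sub continuous_trial.continuousOn)
    (fun z hz hzP ↦ by rw [hb z hzP, trial_eq_re_mul_im hz hzP, sub_self]) hinf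
    integrableOn_gradInner_trial
  refine ⟨W, ⟨hW, fun z hz ↦ ?_, fun z hz ↦ hb z (notMem_cellDomain_of_mem_frontier_hole hz), ?_⟩,
    ?_⟩
  · obtain ⟨h1, h2⟩ := re_mul_im_of_mem_frontier_quadrant hz
    rw [hb z h1, h2]
  · simpa only [norm_gradient_sq] using hE
  · simp only [dirichletEnergy, norm_gradient_sq]
    exact hle'.trans integral_gradInner_trial_le

lemma dirichletEnergy_congr {Ω : Set ℂ} (hΩ : IsOpen Ω) {V W : ℂ → ℝ} (h : EqOn V W Ω) :
    dirichletEnergy Ω V = dirichletEnergy Ω W :=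
  setIntegral_congr_fun hΩ.measurableSet fun z hz ↦ by
    have : V =ᶠ[𝓝 z] W := h.eventuallyEq_of_mem (hΩ.mem_nhds hz)
    simp only [gradient, this.fderiv_eq]

theorem mainTheorem8 :
    (∃ W : ℂ → ℝ, IsCellFunction 1 W ∧
      ∀ W' : ℂ → ℝ, IsCellFunction 1 W' → Set.EqOn W' W (closure (cellDomain 1))) ∧
    cellEnergy 1 ≤ 55 / 18 + 275 * Real.pi / 64 ∧
    (55 / 18 + 275 * Real.pi / 64 : ℝ) < Real.pi * (3 + 2 * Real.sqrt 2) ∧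
    cellEnergy 1 < Real.pi * (3 + 2 * Real.sqrt 2) := by
  obtain ⟨W, hW, hE⟩ := exists_isCellFunction_one
  have hπ := Real.pi_gt_d2
  have h1 : cellEnergy 1 ≤ 55 / 18 + 275 * π / 64 := by
    -- The chosen `cellFunction 1` may differ from `W` off the closure, but uniqueness makes them
    -- agree on the open domain, and hence their gradients there.
    have hcell : IsCellFunction 1 (cellFunction 1) := Classical.epsilon_spec ⟨W, hW⟩
    have : cellEnergy 1 = dirichletEnergy (cellDomain 1) W :=
      dirichletEnergy_congr (isOpen_cellDomain 1) ((hW.eqOn hcell).mono subset_closure)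
    rw [this]
    linarith
  have h2 : 55 / 18 + 275 * π / 64 < π * (3 + 2 * √2) := by
    have : 1.414 < √2 := lt_sqrt_of_sq_lt (by norm_num)
    nlinarith
  exact ⟨⟨W, hW, fun W' ↦ hW.eqOn⟩, h1, h2, h1.trans_lt h2⟩
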